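/- Let $\mathsf{PaB}$ be the operad (in groupoids) of parenthesized braids: the objects of $\mathsf{PaB}(n)$, $n\ge 1$, are the completely parenthesized sequences of the numbers $1,\dots,n$, each occurring exactly once; morphisms are the braids in the Artin braid group $\mathrm{B}_n$ whose permutation carries the labels of the source to those of the target; symmetric groups act by relabelling and the insertions $\circ_i$ are given by cabling. Let $\widehat{\mathsf{PaB}}$ be its profinite completion, and let $\widehat{\mathsf{GT}}$ be the group of continuous automorphisms of the operad $\widehat{\mathsf{PaB}}$ that are the identity on objects (the product is composition). Let $\mathrm{PB}_n\le \mathrm{B}_n$ be the pure braid group, and let $\mathsf{NFI}_{\mathrm{PB}_4}(\mathrm{B}_4)$ be the set of finite index normal subgroups $N\unlhd \mathrm{B}_4$ with $N\le \mathrm{PB}_4$. For $N\in\mathsf{NFI}_{\mathrm{PB}_4}(\mathrm{B}_4)$ let $N_{\mathrm{PB}_3}\le \mathrm{PB}_3$ be the subgroup of those elements that are sent to $N$ by each of the five homomorphisms $\mathrm{PB}_3\to \mathrm{PB}_4$ given by doubling one of the strands or by adding a trivial strand on the left or on the right; let $N_{\mathrm{PB}_2}\le \mathrm{PB}_2$ be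 obtained from $N_{\mathrm{PB}_3}$ in the same way (using the four homomorphisms $\mathrm{PB}_2\to\mathrm{PB}_3$). Reducing the morphisms in arities $4,3,2$ modulo $N, N_{\mathrm{PB}_3},N_{\mathrm{PB}_2}$ gives the quotient $\mathsf{PaB}^{\le 4}/\!\sim_N$ of the truncation $\mathsf{PaB}^{\le 4}$ of $\mathsf{PaB}$ to the arities $1,2,3,4$. All morphisms of truncated operads considered here are the identity on objects. A $\mathsf{GT}$-shadow with the target $N$ is a morphism of truncated operads $\mathsf{PaB}^{\le 4}\to \mathsf{PaB}^{\le 4}/\!\sim_N$ which is onto. The groupoid $\mathsf{GTSh}$ has the set of objects $\mathsf{NFI}_{\mathrm{PB}_4}(\mathrm{B}_4)$; its morphisms from $K$ to $N$ are the isomorphisms of truncated operads $\mathsf{PaB}^{\le 4}/\!\sim_K\;\to\;\mathsf{PaB}^{\le 4}/\!\sim_N$, and such an isomorphism is identified with the $\mathsf{GT}$-shadow with the target $N$ that is its composite with the projection $\mathsf{PaB}^{\le 4}\to\mathsf{PaB}^{\le 4}/\!\sim_K$. For $\hat T\in\widehat{\mathsf{GT}}$ and $N\in\mathsf{NFI}_{\mathrm{PB}_4}(\mathrm{B}_4)$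 let $$T_N:\ \mathsf{PaB}^{\le 4}\longrightarrow \widehat{\mathsf{PaB}}^{\le 4}\overset{\hat T}{\longrightarrow}\widehat{\mathsf{PaB}}^{\le 4}\longrightarrow \mathsf{PaB}^{\le 4}/\!\sim_N$$ be the composite with the canonical maps, and let $T_N^{\mathrm{PB}_4}:\mathrm{PB}_4\to \mathrm{PB}_4/N$ be the homomorphism that $T_N$ induces on the automorphism group $\mathrm{PB}_4$ of the object $((1,2)3)4$. **Proposition.** Each $T_N$ is a $\mathsf{GT}$-shadow with the target $N$. The assignment $$N^{\hat T}:=\ker\big(T_N^{\mathrm{PB}_4}:\mathrm{PB}_4\to \mathrm{PB}_4/N\big)$$ defines a right action of $\widehat{\mathsf{GT}}$ on the set $\mathsf{NFI}_{\mathrm{PB}_4}(\mathrm{B}_4)$ (in particular, $N^{\hat T}\in \mathsf{NFI}_{\mathrm{PB}_4}(\mathrm{B}_4)$). Let $\widehat{\mathsf{GT}}_{\mathsf{NFI}}$ be the corresponding transformation groupoid: its objects are the elements of $\mathsf{NFI}_{\mathrm{PB}_4}(\mathrm{B}_4)$, its morphisms from $N^{(1)}$ to $N^{(2)}$ are the $\hat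 T\in\widehat{\mathsf{GT}}$ with $(N^{(2)})^{\hat T}=N^{(1)}$, and composition is the product $\hat T_1\circ\hat T_2$ of $\widehat{\mathsf{GT}}$. Then the assignment $\hat T\mapsto T_N$, where $N$ is the target of $\hat T$, together with the identity on objects, defines a functor $\mathscr{PR}:\widehat{\mathsf{GT}}_{\mathsf{NFI}}\to\mathsf{GTSh}$. -/

import Mathlib

open CategoryTheory

/-- The defining relations of the Artin braid group with generators `σ_0, …, σ_{k-1}`. -/
def braidRels (k : ℕ) : Set (FreeGroup (Fin k)) :=
  {r | (∃ i j : Fin k, i.val + 1 < j.val ∧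
        r = FreeGroup.of i * FreeGroup.of j * (FreeGroup.of j * FreeGroup.of i)⁻¹) ∨
      (∃ i j : Fin k, i.val + 1 = j.val ∧
        r = FreeGroup.of i * FreeGroup.of j * FreeGroup.of i *
          (FreeGroup.of j * FreeGroup.of i * FreeGroup.of j)⁻¹)}

/-- `Br k` is the Artin braid group on `k + 1` strands (so it has `k` standard generators). -/
abbrev Br (k : ℕ) : Type := PresentedGroup (braidRels k)

/-- The strands of a configuration of `k + 1` strands in which the strand in position `p` has been
replaced by `m + 1` strands: either one of the old strands other than the one in position `p`, or
one of the `m + 1` new strands, which occupy the positions `p, …, p + m`. -/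
def blockEquiv (k m : ℕ) (p : Fin (k + 1)) :
    {a : Fin (k + 1) // a ≠ p} ⊕ Fin (m + 1) ≃ Fin (k + m + 1) where
  toFun := Sum.elim
    (fun a => if a.1.val < p.val then ⟨a.1.val, by omega⟩ else ⟨a.1.val + m, by omega⟩)
    (fun b => ⟨p.val + b.val, by omega⟩)
  invFun q :=
    if h₁ : q.val < p.val then Sum.inl ⟨⟨q.val, by omega⟩, by simp [Fin.ext_iff]; omega⟩
    else if h₂ : q.val ≤ p.val + m then Sum.inr ⟨q.val - p.val, by omega⟩
    else Sum.inl ⟨⟨q.val - m, by omega⟩, by simp [Fin.ext_iff]; omega⟩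
  left_inv := by
    rintro (⟨a, ha⟩ | b)
    · have ha' : a.val ≠ p.val := fun h => ha (Fin.ext h)
      rcases Nat.lt_or_gt_of_ne ha' with h | h
      · simp only [Sum.elim_inl, if_pos h, dif_pos h]
      · have h1 : ¬ a.val < p.val := by omega
        have h2 : ¬ a.val + m < p.val := by omega
        have h3 : ¬ a.val + m ≤ p.val + m := by omega
        simp only [Sum.elim_inl, h1, if_false, h2, dif_neg, h3, not_false_eq_true,
          Nat.add_sub_cancel]
    · have h1 : ¬ p.val + b.val < p.val := by omega
      have h2 : p.val + b.val ≤ p.val + m := by omega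
      simp [h2]
  right_inv := by
    intro q
    dsimp only
    split_ifs with h₁ h₂
    · simp only [Sum.elim_inl, if_pos h₁]
    · simp only [Sum.elim_inr]; ext; simp; omega
    · simp only [Sum.elim_inl]
      rw [if_neg (by omega)]
      ext; simp; omega

/-- Insertion of the permutation `ρ` of `m + 1` strands into the strand of `π` which starts in
position `p`: the block of positions `p, …, p + m` is moved by `π` as one strand, and its strands
are permuted by `ρ`. -/
def permIns {k m : ℕ} (p : Fin (k + 1)) (π : Equiv.Perm (Fin (k + 1)))
    (ρ : Equiv.Perm (Fin (m + 1))) : Equiv.Perm (Fin (k + m + 1)) :=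
  (blockEquiv k m p).symm.trans
    ((Equiv.sumCongr (π.subtypeEquiv (by simp)) ρ).trans (blockEquiv k m (π p)))

theorem permIns_apply {k m : ℕ} (p : Fin (k + 1)) (π : Equiv.Perm (Fin (k + 1)))
    (ρ : Equiv.Perm (Fin (m + 1))) (x : {a : Fin (k + 1) // a ≠ p} ⊕ Fin (m + 1)) :
    permIns p π ρ (blockEquiv k m p x) =
      blockEquiv k m (π p) (Equiv.sumCongr (π.subtypeEquiv (by simp)) ρ x) := by
  simp [permIns]

theorem permIns_mul {k m : ℕ} (p : Fin (k + 1)) (π' π : Equiv.Perm (Fin (k + 1)))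
    (ρ' ρ : Equiv.Perm (Fin (m + 1))) :
    permIns (π p) π' ρ' * permIns p π ρ = permIns p (π' * π) (ρ' * ρ) := by
  refine Equiv.ext fun q => ?_
  obtain ⟨x, rfl⟩ := (blockEquiv k m p).surjective q
  rw [Equiv.Perm.mul_apply, permIns_apply, permIns_apply, permIns_apply]
  rcases x with a | b <;> rfl

theorem permIns_one {k m : ℕ} (p : Fin (k + 1)) :
    permIns p (1 : Equiv.Perm (Fin (k + 1))) (1 : Equiv.Perm (Fin (m + 1))) = 1 := by
  refine Equiv.ext fun q => ?_
  obtain ⟨x, rfl⟩ := (blockEquiv k m p).surjective q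
  rw [permIns_apply]
  rcases x with a | b <;> rfl

/-- The value of `permIns`, position by position. -/
theorem permIns_val {k m : ℕ} (p : Fin (k + 1)) (π : Equiv.Perm (Fin (k + 1)))
    (ρ : Equiv.Perm (Fin (m + 1))) (q : Fin (k + m + 1)) :
    (∃ b : Fin (m + 1), q.val = p.val + b.val ∧
        (permIns p π ρ q).val = (π p).val + (ρ b).val) ∨
      (∃ a : Fin (k + 1), a ≠ p ∧ q.val = (if a.val < p.val then a.val else a.val + m) ∧
        (permIns p π ρ q).val = (if (π a).val < (π p).val then (π a).val else (π a).val + m)) := by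
  obtain ⟨x, rfl⟩ := (blockEquiv k m p).surjective q
  rw [permIns_apply]
  rcases x with ⟨a, ha⟩ | b
  · refine Or.inr ⟨a, ha, ?_, ?_⟩
    · simp only [blockEquiv, Equiv.coe_fn_mk, Sum.elim_inl]; split_ifs <;> rfl
    · simp only [blockEquiv, Equiv.coe_fn_mk, Equiv.sumCongr_apply, Sum.map_inl, Sum.elim_inl,
        Equiv.subtypeEquiv_apply]
      split_ifs <;> rfl
  · exact Or.inl ⟨b, rfl, rfl⟩

namespace Br

/-- The standard generator exchanging the strands in positions `j` and `j + 1`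
(positions are numbered from `0`). -/
def σ {k : ℕ} (j : Fin k) : Br k := PresentedGroup.of j

theorem σ_comm {k : ℕ} {i j : Fin k} (h : i.val + 1 < j.val) : σ i * σ j = σ j * σ i := by
  have := PresentedGroup.one_of_mem (rels := braidRels k) (Or.inl ⟨i, j, h, rfl⟩)
  simp only [map_mul, map_inv] at this
  exact mul_inv_eq_one.mp this

theorem σ_braid {k : ℕ} {i j : Fin k} (h : i.val + 1 = j.val) :
    σ i * σ j * σ i = σ j * σ i * σ j := by
  have := PresentedGroup.one_of_mem (rels := braidRels k) (Or.inr ⟨i, j, h, rfl⟩)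
  simp only [map_mul, map_inv] at this
  exact mul_inv_eq_one.mp this

/-- The universal property of the braid group. -/
def lift {k : ℕ} {G : Type*} [Group G] (f : Fin k → G)
    (h₁ : ∀ i j : Fin k, i.val + 1 < j.val → f i * f j = f j * f i)
    (h₂ : ∀ i j : Fin k, i.val + 1 = j.val → f i * f j * f i = f j * f i * f j) : Br k →* G :=
  PresentedGroup.toGroup (f := f) (by
    rintro r (⟨i, j, h, rfl⟩ | ⟨i, j, h, rfl⟩)
    · simp only [map_mul, map_inv, FreeGroup.lift_apply_of]
      exact mul_inv_eq_one.mpr (h₁ i j h)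
    · simp only [map_mul, map_inv, FreeGroup.lift_apply_of]
      exact mul_inv_eq_one.mpr (h₂ i j h))

@[simp] theorem lift_σ {k : ℕ} {G : Type*} [Group G] (f : Fin k → G)
    (h₁ : ∀ i j : Fin k, i.val + 1 < j.val → f i * f j = f j * f i)
    (h₂ : ∀ i j : Fin k, i.val + 1 = j.val → f i * f j * f i = f j * f i * f j) (j : Fin k) :
    lift f h₁ h₂ (σ j) = f j := PresentedGroup.toGroup.of _

@[elab_as_elim]
theorem induction {k : ℕ} {C : Br k → Prop} (one : C 1) (gen : ∀ j, C (σ j))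
    (mul : ∀ a b, C a → C b → C (a * b)) (inv : ∀ a, C a → C a⁻¹) (g : Br k) : C g := by
  have hg : g ∈ Subgroup.closure (Set.range (σ (k := k))) := by
    have := PresentedGroup.closure_range_of (braidRels k)
    exact this ▸ Subgroup.mem_top g
  induction hg using Subgroup.closure_induction with
  | mem x hx => obtain ⟨j, rfl⟩ := hx; exact gen j
  | one => exact one
  | mul a b _ _ ha hb => exact mul a b ha hb
  | inv a _ ha => exact inv a ha

/-- The permutation of a braid: the strand which starts in position `p` ends in position
`perm g p`.  In the product `g * h` the braid `h` comes first. -/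
def perm (k : ℕ) : Br k →* Equiv.Perm (Fin (k + 1)) :=
  lift (fun j => Equiv.swap j.castSucc j.succ)
    (by
      intro i j h
      ext p
      simp only [Equiv.Perm.mul_apply, Equiv.swap_apply_def, Fin.ext_iff, Fin.val_castSucc,
        Fin.val_succ, apply_ite Fin.val]
      split_ifs <;> omega)
    (by
      intro i j h
      have e : i.succ = j.castSucc := Fin.ext (by simp; omega)
      have h1 : i.castSucc ≠ j.castSucc := by simp [Fin.ext_iff]; omega
      have h2 : i.castSucc ≠ j.succ := by simp [Fin.ext_iff]; omega
      have h3 : j.succ ≠ j.castSucc := by simp [Fin.ext_iff]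
      rw [e, Equiv.swap_mul_swap_mul_swap h1 h2, Equiv.swap_comm i.castSucc,
        Equiv.swap_comm j.castSucc j.succ, Equiv.swap_mul_swap_mul_swap h3 h2.symm,
        Equiv.swap_comm])

@[simp] theorem perm_σ {k : ℕ} (j : Fin k) : perm k (σ j) = Equiv.swap j.castSucc j.succ :=
  lift_σ _ _ _ j

/-- The pure braid group on `k + 1` strands. -/
def PB (k : ℕ) : Subgroup (Br k) := (perm k).ker

/-- Doubling the strand which starts in position `p`, for a standard generator. -/
def dblGen {k : ℕ} (j : Fin k) (p : Fin (k + 1)) : Br (k + 1) :=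
  if p.val < j.val then σ j.succ
  else if p.val = j.val then σ j.castSucc * σ j.succ
  else if p.val = j.val + 1 then σ j.succ * σ j.castSucc
  else σ j.castSucc

theorem dblGen_lt {k : ℕ} {j : Fin k} {p : Fin (k + 1)} (h : p.val < j.val) :
    dblGen j p = σ j.succ := by simp [dblGen, h]
theorem dblGen_eq {k : ℕ} {j : Fin k} {p : Fin (k + 1)} (h : p.val = j.val) :
    dblGen j p = σ j.castSucc * σ j.succ := by simp [dblGen, h]
theorem dblGen_eq' {k : ℕ} {j : Fin k} {p : Fin (k + 1)} (h : p.val = j.val + 1) :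
    dblGen j p = σ j.succ * σ j.castSucc := by simp [dblGen, h]
theorem dblGen_gt {k : ℕ} {j : Fin k} {p : Fin (k + 1)} (h : j.val + 1 < p.val) :
    dblGen j p = σ j.castSucc := by
  unfold dblGen
  rw [if_neg (by omega), if_neg (by omega), if_neg (by omega)]

theorem dblGen_comm {k : ℕ} {i j : Fin k} (h : i.val + 1 < j.val) (p : Fin (k + 1)) :
    dblGen i (Equiv.swap j.castSucc j.succ p) * dblGen j p =
      dblGen j (Equiv.swap i.castSucc i.succ p) * dblGen i p := by
  have c1 : σ i.castSucc * σ j.castSucc = σ j.castSucc * σ i.castSucc :=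
    σ_comm (by simp; omega)
  have c2 : σ i.castSucc * σ j.succ = σ j.succ * σ i.castSucc := σ_comm (by simp; omega)
  have c3 : σ i.succ * σ j.succ = σ j.succ * σ i.succ := σ_comm (by simp; omega)
  rcases lt_trichotomy p.val i.val with hp | hp | hp
  · rw [Equiv.swap_apply_of_ne_of_ne, Equiv.swap_apply_of_ne_of_ne, dblGen_lt hp,
      dblGen_lt (by omega)] <;> first | exact c3 | (simp [Fin.ext_iff]; omega)
  · obtain rfl : p = i.castSucc := Fin.ext hp
    rw [Equiv.swap_apply_left, Equiv.swap_apply_of_ne_of_ne, dblGen_eq (by simp),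
      dblGen_lt (by simp; omega), dblGen_lt (by simp; omega)]
    · rw [mul_assoc, c3, ← mul_assoc, c2, mul_assoc]
    · simp [Fin.ext_iff]; omega
    · simp [Fin.ext_iff]; omega
  rcases eq_or_lt_of_le (Nat.succ_le_of_lt hp) with hp' | hp'
  · obtain rfl : p = i.succ := Fin.ext hp'.symm
    rw [Equiv.swap_apply_right, Equiv.swap_apply_of_ne_of_ne, dblGen_eq' (by simp),
      dblGen_lt (by simp; omega), dblGen_lt (by simp; omega)]
    · rw [mul_assoc, c2, ← mul_assoc, c3, mul_assoc]
    · simp [Fin.ext_iff]; omega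
    · simp [Fin.ext_iff]; omega
  rcases lt_trichotomy p.val j.val with hq | hq | hq
  · rw [Equiv.swap_apply_of_ne_of_ne, Equiv.swap_apply_of_ne_of_ne, dblGen_lt hq,
      dblGen_gt (by omega)] <;> first | exact c2 | (simp [Fin.ext_iff]; omega)
  · obtain rfl : p = j.castSucc := Fin.ext hq
    rw [Equiv.swap_apply_left, Equiv.swap_apply_of_ne_of_ne, dblGen_eq (j := j) (by simp),
      dblGen_gt (by simp; omega), dblGen_gt (by simp; omega)]
    · rw [← mul_assoc, c1, mul_assoc, c2, ← mul_assoc]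
    · simp [Fin.ext_iff]; omega
    · simp [Fin.ext_iff]; omega
  rcases eq_or_lt_of_le (Nat.succ_le_of_lt hq) with hq' | hq'
  · obtain rfl : p = j.succ := Fin.ext hq'.symm
    rw [Equiv.swap_apply_right, Equiv.swap_apply_of_ne_of_ne, dblGen_eq' (j := j) (by simp),
      dblGen_gt (by simp; omega), dblGen_gt (by simp; omega)]
    · rw [← mul_assoc, c2, mul_assoc, c1, ← mul_assoc]
    · simp [Fin.ext_iff]; omega
    · simp [Fin.ext_iff]; omega
  · rw [Equiv.swap_apply_of_ne_of_ne, Equiv.swap_apply_of_ne_of_ne, dblGen_gt (by omega),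
      dblGen_gt (by omega)] <;> first | exact c1 | (simp [Fin.ext_iff]; omega)

theorem dblGen_braid {k : ℕ} {i j : Fin k} (h : i.val + 1 = j.val) (p : Fin (k + 1)) :
    dblGen i (Equiv.swap j.castSucc j.succ (Equiv.swap i.castSucc i.succ p)) *
        (dblGen j (Equiv.swap i.castSucc i.succ p) * dblGen i p) =
      dblGen j (Equiv.swap i.castSucc i.succ (Equiv.swap j.castSucc j.succ p)) *
        (dblGen i (Equiv.swap j.castSucc j.succ p) * dblGen j p) := by
  have e : i.succ = j.castSucc := Fin.ext (by simp; omega)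
  -- the three generators involved
  obtain ⟨a, ha⟩ : ∃ a, a = σ i.castSucc := ⟨_, rfl⟩
  obtain ⟨b, hb⟩ : ∃ b, b = σ j.castSucc := ⟨_, rfl⟩
  obtain ⟨c, hc⟩ : ∃ c, c = σ j.succ := ⟨_, rfl⟩
  have ab : a * b * a = b * a * b := by subst ha hb; exact σ_braid (by simp; omega)
  have bc : b * c * b = c * b * c := by subst hb hc; exact σ_braid (by simp)
  have ac : a * c = c * a := by subst ha hc; exact σ_comm (by simp; omega)
  rcases lt_trichotomy p.val i.val with hp | hp | hp
  · have s1 : Equiv.swap i.castSucc i.succ p = p :=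
      Equiv.swap_apply_of_ne_of_ne (by simp [Fin.ext_iff]; omega) (by simp [Fin.ext_iff]; omega)
    have s2 : Equiv.swap j.castSucc j.succ p = p :=
      Equiv.swap_apply_of_ne_of_ne (by simp [Fin.ext_iff]; omega) (by simp [Fin.ext_iff]; omega)
    rw [s1, s2, s1, dblGen_lt hp, dblGen_lt (by omega), e, ← hb, ← hc, ← mul_assoc, bc, mul_assoc]
  · obtain rfl : p = i.castSucc := Fin.ext hp
    have s2 : Equiv.swap j.castSucc j.succ i.castSucc = i.castSucc :=
      Equiv.swap_apply_of_ne_of_ne (by simp [Fin.ext_iff]; omega) (by simp [Fin.ext_iff]; omega)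
    rw [s2, Equiv.swap_apply_left, e, Equiv.swap_apply_left, dblGen_gt (j := i) (by simp; omega),
      dblGen_eq (j := j) (by simp), dblGen_eq (j := i) (by simp),
      dblGen_lt (j := j) (by simp; omega), e, ← ha, ← hb, ← hc]
    calc a * (b * c * (a * b)) = a * b * (c * a) * b := by group
      _ = a * b * a * (c * b) := by rw [← ac]; group
      _ = b * a * (b * c * b) := by rw [ab]; group
      _ = b * (a * c) * (b * c) := by rw [bc]; group
      _ = b * c * (a * b * c) := by rw [ac]; group
  rcases eq_or_lt_of_le (Nat.succ_le_of_lt hp) with hp' | hp'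
  · obtain rfl : p = i.succ := Fin.ext hp'.symm
    have s2 : Equiv.swap j.castSucc j.succ i.castSucc = i.castSucc :=
      Equiv.swap_apply_of_ne_of_ne (by simp [Fin.ext_iff]; omega) (by simp [Fin.ext_iff]; omega)
    have s3 : Equiv.swap i.castSucc j.castSucc j.succ = j.succ :=
      Equiv.swap_apply_of_ne_of_ne (by simp [Fin.ext_iff]; omega) (by simp [Fin.ext_iff])
    rw [Equiv.swap_apply_right, s2, e, Equiv.swap_apply_left, s3,
      dblGen_eq (j := i) (by simp), dblGen_lt (j := j) (by simp; omega),
      dblGen_eq' (j := i) (by simp; omega), dblGen_eq' (j := j) (by simp),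
      dblGen_gt (j := i) (by simp; omega), dblGen_eq (j := j) (by simp), e, ← ha, ← hb, ← hc]
    calc a * b * (c * (b * a)) = a * (b * c * b) * a := by group
      _ = (a * c) * b * (c * a) := by rw [bc]; group
      _ = (c * a) * b * (c * a) := by rw [ac]
      _ = (c * a) * b * (a * c) := congrArg (c * a * b * ·) ac.symm
      _ = c * (a * b * a) * c := by group
      _ = c * b * (a * (b * c)) := by rw [ab]; group
  rcases eq_or_lt_of_le (Nat.succ_le_of_lt hp') with hq | hq
  · obtain rfl : p = j.succ := Fin.ext (by simp; omega)
    have s1 : Equiv.swap i.castSucc i.succ j.succ = j.succ :=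
      Equiv.swap_apply_of_ne_of_ne (by simp [Fin.ext_iff]; omega) (by simp [Fin.ext_iff]; omega)
    have s2 : Equiv.swap j.castSucc j.succ i.castSucc = i.castSucc :=
      Equiv.swap_apply_of_ne_of_ne (by simp [Fin.ext_iff]; omega) (by simp [Fin.ext_iff]; omega)
    rw [s1, Equiv.swap_apply_right, e, Equiv.swap_apply_right,
      dblGen_eq' (j := i) (by simp; omega), dblGen_eq' (j := j) (by simp),
      dblGen_gt (j := i) (by simp; omega), dblGen_lt (j := j) (by simp; omega), e, ← ha, ← hb, ← hc]
    calc b * a * (c * b * a) = b * (a * c) * b * a := by group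
      _ = (b * c) * (a * b * a) := by rw [ac]; group
      _ = (b * c * b) * a * b := by rw [ab]; group
      _ = c * b * (c * a) * b := by rw [bc]; group
      _ = c * (b * a * (c * b)) := by rw [← ac]; group
  · have s1 : Equiv.swap i.castSucc i.succ p = p :=
      Equiv.swap_apply_of_ne_of_ne (by simp [Fin.ext_iff]; omega) (by simp [Fin.ext_iff]; omega)
    have s2 : Equiv.swap j.castSucc j.succ p = p :=
      Equiv.swap_apply_of_ne_of_ne (by simp [Fin.ext_iff]; omega) (by simp [Fin.ext_iff]; omega)
    rw [s1, s2, s1, dblGen_gt (by omega), dblGen_gt (by omega), ← ha, ← hb, ← mul_assoc, ab,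
      mul_assoc]

/-- The braid group acts on pairs `(p, h)` of a position and a braid with one more strand: `g`
moves the position `p` along its strand and multiplies `h` by `g` with that strand doubled.
This packages the crossed homomorphism rule `dbl_mul` below. -/
def dblAct (k : ℕ) : Br k →* Equiv.Perm (Fin (k + 1) × Br (k + 1)) :=
  lift (fun j => Equiv.prodShear (Equiv.swap j.castSucc j.succ) fun p => Equiv.mulLeft (dblGen j p))
    (by
      intro i j h
      ext1 ⟨p, x⟩
      have hp := congrArg (fun f => f p) (congrArg (fun f : Equiv.Perm _ => (f : _ → _))
        (congrArg (perm k) (σ_comm h)))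
      simp only [map_mul, perm_σ, Equiv.Perm.mul_apply] at hp
      refine Prod.ext hp ?_
      simp only [Equiv.Perm.mul_apply, Equiv.prodShear_apply, Equiv.coe_mulLeft, ← mul_assoc]
      rw [dblGen_comm h])
    (by
      intro i j h
      ext1 ⟨p, x⟩
      have hp := congrArg (fun f => f p) (congrArg (fun f : Equiv.Perm _ => (f : _ → _))
        (congrArg (perm k) (σ_braid h)))
      simp only [map_mul, perm_σ, Equiv.Perm.mul_apply] at hp
      refine Prod.ext hp ?_
      have := dblGen_braid h p
      simp only [Equiv.Perm.mul_apply, Equiv.prodShear_apply, Equiv.coe_mulLeft]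
      simp only [← mul_assoc] at this ⊢
      rw [this])

/-- `dbl p g` is the braid `g` with the strand which starts in position `p` doubled. -/
def dbl {k : ℕ} (p : Fin (k + 1)) (g : Br k) : Br (k + 1) := (dblAct k g (p, 1)).2

theorem dblAct_apply {k : ℕ} (g : Br k) (p : Fin (k + 1)) (x : Br (k + 1)) :
    dblAct k g (p, x) = (perm k g p, dbl p g * x) := by
  have key : ∀ p x, dblAct k g (p, x) = (perm k g p, (dblAct k g (p, 1)).2 * x) := by
    induction g using induction with
    | one => simp
    | gen j => intro p x; simp [dblAct, Equiv.prodShear_apply]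
    | mul a b ha hb =>
      intro p x
      simp only [map_mul, Equiv.Perm.mul_apply]
      rw [hb p x, ha, hb p 1, ha _ (_ * 1)]
      simp [mul_assoc]
    | inv a ha =>
      intro p x
      have h1 := ha ((perm k a)⁻¹ p) 1
      have h2 : ∀ y, dblAct k a ((perm k a)⁻¹ p, y) =
          (p, (dblAct k a ((perm k a)⁻¹ p, 1)).2 * y) := by
        intro y; rw [ha]; simp
      have h3 : ∀ y, dblAct k a⁻¹ (p, y) =
          ((perm k a)⁻¹ p, ((dblAct k a ((perm k a)⁻¹ p, 1)).2)⁻¹ * y) := by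
        intro y
        rw [map_inv, Equiv.Perm.inv_eq_iff_eq, h2]
        simp
      rw [h3, h3 1]
      simp
  exact key p x

@[simp] theorem dbl_σ {k : ℕ} (p : Fin (k + 1)) (j : Fin k) : dbl p (σ j) = dblGen j p := by
  simp [dbl, dblAct, Equiv.prodShear_apply]

theorem dbl_mul {k : ℕ} (p : Fin (k + 1)) (g h : Br k) :
    dbl p (g * h) = dbl (perm k h p) g * dbl p h := by
  conv_lhs => rw [dbl, map_mul, Equiv.Perm.mul_apply, dblAct_apply, dblAct_apply]
  simp

@[simp] theorem dbl_one {k : ℕ} (p : Fin (k + 1)) : dbl p (1 : Br k) = 1 := by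
  simp [dbl]

theorem val_swap {k : ℕ} (j : Fin k) (p : Fin (k + 1)) :
    (Equiv.swap j.castSucc j.succ p).val =
      if p.val = j.val then j.val + 1 else if p.val = j.val + 1 then j.val else p.val := by
  simp only [Equiv.swap_apply_def, Fin.ext_iff, Fin.val_castSucc, Fin.val_succ]
  split_ifs <;> simp

theorem perm_dblGen {k : ℕ} (p : Fin (k + 1)) (j : Fin k) :
    perm (k + 1) (dblGen j p) =
      permIns p (Equiv.swap j.castSucc j.succ) (1 : Equiv.Perm (Fin 2)) := by
  refine Equiv.ext fun q => Fin.ext ?_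
  have hv := permIns_val p (Equiv.swap j.castSucc j.succ) (1 : Equiv.Perm (Fin 2)) q
  have ne : ∀ a : Fin (k + 1), a ≠ p → a.val ≠ p.val := fun a ha h => ha (Fin.ext h)
  have e1 := val_swap j p
  rcases lt_trichotomy p.val j.val with hp | hp | hp
  · rw [dblGen_lt hp, perm_σ, val_swap]
    rcases hv with ⟨b, h1, h2⟩ | ⟨a, h0, h1, h2⟩
    · rw [h2, e1]; simp; split_ifs <;> omega
    · have := ne a h0
      rw [h2, e1, val_swap]; simp only [Fin.val_succ]; split_ifs at h1 ⊢ <;> omega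
  · rw [dblGen_eq hp, map_mul, Equiv.Perm.mul_apply, perm_σ, perm_σ, val_swap, val_swap]
    rcases hv with ⟨b, h1, h2⟩ | ⟨a, h0, h1, h2⟩
    · rw [h2, e1]; simp; split_ifs <;> omega
    · have := ne a h0
      rw [h2, e1, val_swap]; simp only [Fin.val_succ, Fin.val_castSucc]
      split_ifs at h1 ⊢ <;> omega
  rcases eq_or_lt_of_le (Nat.succ_le_of_lt hp) with hp' | hp'
  · rw [dblGen_eq' hp'.symm, map_mul, Equiv.Perm.mul_apply, perm_σ, perm_σ, val_swap, val_swap]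
    rcases hv with ⟨b, h1, h2⟩ | ⟨a, h0, h1, h2⟩
    · rw [h2, e1]; simp; split_ifs <;> omega
    · have := ne a h0
      rw [h2, e1, val_swap]; simp only [Fin.val_succ, Fin.val_castSucc]
      split_ifs at h1 ⊢ <;> omega
  · rw [dblGen_gt hp', perm_σ, val_swap]
    rcases hv with ⟨b, h1, h2⟩ | ⟨a, h0, h1, h2⟩
    · rw [h2, e1]; simp; split_ifs <;> omega
    · have := ne a h0
      rw [h2, e1, val_swap]; simp only [Fin.val_castSucc]; split_ifs at h1 ⊢ <;> omega

theorem dbl_inv {k : ℕ} (p : Fin (k + 1)) (g : Br k) :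
    dbl (perm k g p) g⁻¹ = (dbl p g)⁻¹ := by
  have := dbl_mul p g⁻¹ g
  rw [inv_mul_cancel, dbl_one] at this
  exact eq_inv_of_mul_eq_one_left this.symm

theorem perm_dbl {k : ℕ} (p : Fin (k + 1)) (g : Br k) :
    perm (k + 1) (dbl p g) = permIns p (perm k g) (1 : Equiv.Perm (Fin 2)) := by
  induction g using induction generalizing p with
  | one => rw [dbl_one, map_one, map_one, permIns_one]
  | gen j => rw [dbl_σ, perm_dblGen, perm_σ]
  | mul a b ha hb => rw [dbl_mul, map_mul, ha, hb, permIns_mul, map_mul, one_mul]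
  | inv a ha =>
    obtain ⟨q, rfl⟩ := (perm k a).surjective p
    rw [dbl_inv, map_inv, ha, inv_eq_iff_mul_eq_one, map_inv]
    have := permIns_mul q (perm k a)⁻¹ (perm k a) (1 : Equiv.Perm (Fin 2)) 1
    rw [inv_mul_cancel, one_mul, permIns_one] at this
    exact mul_eq_one_comm.mp this

/-- `place n p h` puts the braid `h` on the strands in positions `p, …, p + m` of the trivial braid
on `n + 1` strands. -/
def place {m : ℕ} (n p : ℕ) (hp : p + m ≤ n) : Br m →* Br n :=
  lift (fun j => σ ⟨p + j.val, by omega⟩)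
    (fun i j h => σ_comm (by simp; omega)) (fun i j h => σ_braid (by simp; omega))

@[simp] theorem place_σ {m : ℕ} (n p : ℕ) (hp : p + m ≤ n) (j : Fin m) :
    place n p hp (σ j) = σ ⟨p + j.val, by omega⟩ := lift_σ _ _ _ j

/-- `cab m p g` is the braid `g` with the strand which starts in position `p` replaced
by `m + 1` parallel strands. -/
def cab {k : ℕ} : (m : ℕ) → Fin (k + 1) → Br k → Br (k + m)
  | 0, _, g => g
  | m + 1, p, g => dbl (Fin.castLE (n := k + 1) (m := k + m + 1) (by omega) p) (cab m p g)

/-- Insertion of the braid `h` into the strand of `g` which starts in position `p`. -/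
def ins {k m : ℕ} (p : Fin (k + 1)) (g : Br k) (h : Br m) : Br (k + m) :=
  cab m p g * place (k + m) p.val (by omega) h

theorem cab_succ {k : ℕ} (m : ℕ) (p : Fin (k + 1)) (g : Br k) :
    cab (m + 1) p g =
      dbl (k := k + m) (Fin.castLE (n := k + 1) (m := k + m + 1) (by omega) p) (cab m p g) := rfl

theorem perm_cab {k : ℕ} (m : ℕ) (p : Fin (k + 1)) (g : Br k) :
    perm (k + m) (cab m p g) = permIns p (perm k g) (1 : Equiv.Perm (Fin (m + 1))) := by
  induction m with
  | zero =>
    refine Equiv.ext fun q => Fin.ext ?_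
    change (perm k g q).val = _
    rcases permIns_val p (perm k g) (1 : Equiv.Perm (Fin 1)) q with ⟨b, h1, h2⟩ | ⟨a, h0, h1, h2⟩
    · obtain rfl : q = p := Fin.ext (by omega)
      rw [h2]; simp
    · obtain rfl : q = a := Fin.ext (by rw [h1]; split_ifs <;> rfl)
      rw [h2]; split_ifs <;> rfl
  | succ m ih =>
    rw [cab_succ]
    refine (perm_dbl (k := k + m) _ _).trans ?_
    rw [ih]
    have hp : (permIns p (perm k g) (1 : Equiv.Perm (Fin (m + 1)))
        (Fin.castLE (n := k + 1) (m := k + m + 1) (by omega) p)).val = (perm k g p).val := by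
      rcases permIns_val p (perm k g) (1 : Equiv.Perm (Fin (m + 1)))
        (Fin.castLE (n := k + 1) (m := k + m + 1) (by omega) p) with
        ⟨b, h1, h2⟩ | ⟨a, h0, h1, h2⟩
      · rw [h2]; simp at h1 ⊢; omega
      · have : a.val ≠ p.val := fun h => h0 (Fin.ext h)
        simp only [Fin.val_castLE] at h1
        split_ifs at h1 <;> omega
    refine Equiv.ext fun q => Fin.ext ?_
    have inj : ∀ a, a ≠ p → (perm k g a).val ≠ (perm k g p).val :=
      fun a ha h => ha ((perm k g).injective (Fin.ext h))
    have ne : ∀ a : Fin (k + 1), a ≠ p → a.val ≠ p.val := fun a ha h => ha (Fin.ext h)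
    have hR := permIns_val p (perm k g) (1 : Equiv.Perm (Fin (m + 1 + 1))) q
    rcases permIns_val (Fin.castLE (n := k + 1) (m := k + m + 1) (by omega) p)
        (permIns p (perm k g) (1 : Equiv.Perm (Fin (m + 1)))) (1 : Equiv.Perm (Fin 2)) q with
        ⟨b, h1, h2⟩ | ⟨a, h0, h1, h2⟩
    · rw [h2, hp]
      simp only [Fin.val_castLE, Equiv.Perm.one_apply] at h1 ⊢
      rcases hR with ⟨b', h1', h2'⟩ | ⟨a', h0', h1', h2'⟩
      · rw [h2']; simp only [Equiv.Perm.one_apply]; omega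
      · have := ne a' h0'
        split_ifs at h1' <;> omega
    · rw [h2, hp]
      have h0v : a.val ≠ p.val := fun h => h0 (Fin.ext h)
      simp only [Fin.val_castLE] at h1
      rcases permIns_val p (perm k g) (1 : Equiv.Perm (Fin (m + 1))) a with
        ⟨c, h3, h4⟩ | ⟨c, h3', h3, h4⟩
      · have h4' : (permIns p (perm k g) (1 : Equiv.Perm (Fin (m + 1))) a).val =
          (perm k g p).val + c.val := h4
        rw [h4']
        rcases hR with ⟨b', h1', h2'⟩ | ⟨a', h0', h1', h2'⟩
        · rw [h2']; simp only [Equiv.Perm.one_apply]; split_ifs at h1 ⊢ <;> omega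
        · have := ne a' h0'
          split_ifs at h1 h1' <;> omega
      · rw [h4]
        have := ne c h3'
        have := inj c h3'
        rcases hR with ⟨b', h1', h2'⟩ | ⟨a', h0', h1', h2'⟩
        · split_ifs at h1 h3 <;> omega
        · have := ne a' h0'
          obtain rfl : a' = c := Fin.ext (by split_ifs at h1 h1' h3 <;> omega)
          rw [h2']; split_ifs <;> omega

theorem perm_place {k m : ℕ} (p : Fin (k + 1)) (h : Br m) :
    perm (k + m) (place (k + m) p.val (by omega) h) = permIns p 1 (perm m h) := by
  induction h using induction with
  | one => simp [permIns_one]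
  | gen j =>
    refine Equiv.ext fun q => Fin.ext ?_
    rw [place_σ, perm_σ, val_swap, perm_σ]
    rcases permIns_val p 1 (Equiv.swap j.castSucc j.succ) q with ⟨b, h1, h2⟩ | ⟨a, h0, h1, h2⟩
    · rw [h2, val_swap]; simp only [Equiv.Perm.one_apply]; split_ifs <;> omega
    · have : a.val ≠ p.val := fun h => h0 (Fin.ext h)
      have h2' : (permIns p 1 (Equiv.swap j.castSucc j.succ) q).val =
        if a.val < p.val then a.val else a.val + m := h2
      rw [h2']
      by_cases hc : a.val < p.val
      · rw [if_pos hc] at h1 ⊢; dsimp only; split_ifs <;> omega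
      · rw [if_neg hc] at h1 ⊢; dsimp only; split_ifs <;> omega
  | mul a b ha hb =>
    rw [map_mul, map_mul, ha, hb, map_mul]
    exact permIns_mul p 1 1 _ _
  | inv a ha =>
    rw [map_inv, map_inv, ha, map_inv, inv_eq_iff_mul_eq_one]
    refine (permIns_mul p 1 1 _ _).trans ?_
    rw [mul_inv_cancel, mul_one, permIns_one]

theorem perm_ins {k m : ℕ} (p : Fin (k + 1)) (g : Br k) (h : Br m) :
    perm (k + m) (ins p g h) = permIns p (perm k g) (perm m h) := by
  rw [ins, map_mul, perm_cab, perm_place]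
  refine (permIns_mul p _ 1 _ _).trans ?_
  rw [mul_one, one_mul]

theorem perm_cab_apply {k : ℕ} (m : ℕ) (p : Fin (k + 1)) (g : Br k) :
    perm (k + m) (cab m p g) (Fin.castLE (n := k + 1) (m := k + m + 1) (by omega) p) =
      Fin.castLE (by omega) (perm k g p) := by
  rw [perm_cab]
  refine Fin.ext ?_
  rcases permIns_val p (perm k g) (1 : Equiv.Perm (Fin (m + 1)))
    (Fin.castLE (n := k + 1) (m := k + m + 1) (by omega) p) with ⟨b, h1, h2⟩ | ⟨a, h0, h1, h2⟩
  · rw [h2]; simp at h1 ⊢; omega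
  · have : a.val ≠ p.val := fun h => h0 (Fin.ext h)
    simp only [Fin.val_castLE] at h1
    split_ifs at h1 <;> omega

theorem cab_mul {k : ℕ} (m : ℕ) (p : Fin (k + 1)) (g h : Br k) :
    cab m p (g * h) = cab m (perm k h p) g * cab m p h := by
  induction m with
  | zero => rfl
  | succ m ih =>
    rw [cab_succ, ih]
    refine (dbl_mul (k := k + m) _ _ _).trans ?_
    rw [perm_cab_apply]
    rfl


theorem place_self {m : ℕ} (h : Br m) : place m 0 (by omega) h = h := by
  induction h using induction with
  | one => simp
  | gen j => rw [place_σ]; congr 1; exact Fin.ext (Nat.zero_add _)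
  | mul a b ha hb => rw [map_mul, ha, hb]
  | inv a ha => rw [map_inv, ha]

theorem place_place {m n r : ℕ} (p q : ℕ) (hp : p + m ≤ n) (hq : q + n ≤ r) (h : Br m) :
    place r q hq (place n p hp h) = place r (q + p) (by omega) h := by
  induction h using induction with
  | one => simp
  | gen j => rw [place_σ, place_σ, place_σ]; congr 1; exact Fin.ext (by simp; omega)
  | mul a b ha hb => rw [map_mul, map_mul, ha, hb, map_mul]
  | inv a ha => rw [map_inv, map_inv, ha, map_inv]

end Br

section CrossedPull

variable {G H I : Type*} [Group G] [Group H]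

variable {a : G →* Equiv.Perm I} {c : I → G → H}

theorem crossed_one (hc : ∀ i g h, c i (g * h) = c (a h i) g * c i h) (i : I) : c i 1 = 1 := by
  have := hc i 1 1
  rw [mul_one, map_one, Equiv.Perm.one_apply] at this
  exact left_eq_mul.mp this

theorem crossed_inv (hc : ∀ i g h, c i (g * h) = c (a h i) g * c i h) (i : I) (g : G) :
    c (a g i) g⁻¹ = (c i g)⁻¹ := by
  have := hc i g⁻¹ g
  rw [inv_mul_cancel, crossed_one hc] at this
  exact eq_inv_of_mul_eq_one_left this.symm

/-- Preimage of a normal subgroup under a family of crossed homomorphisms: the elements of `G` which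
act trivially on the index set and which are mapped into `N` by all members of the family. -/
def crossedPull (a : G →* Equiv.Perm I) (c : I → G → H)
    (hc : ∀ i g h, c i (g * h) = c (a h i) g * c i h) (N : Subgroup H) : Subgroup G where
  carrier := {g | a g = 1 ∧ ∀ i, c i g ∈ N}
  one_mem' := ⟨map_one a, fun i => by rw [crossed_one hc]; exact N.one_mem⟩
  mul_mem' := by
    rintro g h ⟨hg, hg'⟩ ⟨hh, hh'⟩
    refine ⟨by rw [map_mul, hg, hh, one_mul], fun i => ?_⟩
    rw [hc]
    exact N.mul_mem (hg' _) (hh' _)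
  inv_mem' := by
    rintro g ⟨hg, hg'⟩
    refine ⟨by rw [map_inv, hg, inv_one], fun i => ?_⟩
    have h1 := crossed_inv hc i g
    rw [hg, Equiv.Perm.one_apply] at h1
    rw [h1]
    exact N.inv_mem (hg' i)

variable {hc : ∀ i g h, c i (g * h) = c (a h i) g * c i h} {N : Subgroup H}

instance crossedPull_normal [hN : N.Normal] : (crossedPull a c hc N).Normal where
  conj_mem := by
    rintro x ⟨hx, hx'⟩ g
    refine ⟨by rw [map_mul, map_mul, hx, mul_one, map_inv, mul_inv_cancel], fun i => ?_⟩
    obtain ⟨j, rfl⟩ := (a g).surjective i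
    have : a g⁻¹ (a g j) = j := by rw [map_inv]; simp
    rw [hc, hc, this, hx, Equiv.Perm.one_apply, crossed_inv hc]
    exact hN.conj_mem _ (hx' j) _

instance crossedPull_finiteIndex [Finite I] [N.Normal] [N.FiniteIndex] :
    (crossedPull a c hc N).FiniteIndex := by
  have : Finite (G ⧸ crossedPull a c hc N) := by
    let f : G → Equiv.Perm I × (I → H ⧸ N) := fun g => (a g, fun i => (c i g : H ⧸ N))
    refine Finite.of_injective (β := Set.range f) (fun x => ⟨f x.out, _, rfl⟩) ?_
    intro x y hxy
    have hxy' : f x.out = f y.out := congrArg Subtype.val hxy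
    have h1 : a x.out = a y.out := congrArg Prod.fst hxy'
    have h2 : ∀ i, (c i x.out : H ⧸ N) = c i y.out := fun i => congrFun (congrArg Prod.snd hxy') i
    rw [← x.out_eq', ← y.out_eq']
    refine QuotientGroup.eq.mpr ⟨by rw [map_mul, map_inv, h1, inv_mul_cancel], fun i => ?_⟩
    rw [hc, ← h1, crossed_inv hc]
    exact QuotientGroup.eq.mp (h2 i)
  exact Subgroup.finiteIndex_of_finite_quotient

end CrossedPull

namespace Br

instance PB_finiteIndex (k : ℕ) : (PB k).FiniteIndex := by unfold PB; infer_instance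

instance PB_normal (k : ℕ) : (PB k).Normal := by unfold PB; infer_instance

/-- The pure braids all of whose cablings by `m + 1` strands lie in `N`. -/
def cabPull (k m : ℕ) (N : FiniteIndexNormalSubgroup (Br (k + m))) :
    FiniteIndexNormalSubgroup (Br k) where
  toSubgroup := crossedPull (perm k) (cab m) (cab_mul m) N.toSubgroup

/-- The braids all of whose placements in the trivial braid on `k + m + 1` strands lie in `N`. -/
def placePull (k m : ℕ) (N : FiniteIndexNormalSubgroup (Br (k + m))) :
    FiniteIndexNormalSubgroup (Br m) where
  toSubgroup := ⨅ p : Fin (k + 1), N.toSubgroup.comap (place (k + m) p.val (by omega))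
  isNormal' := Subgroup.normal_iInf_normal fun _ => inferInstance
  isFiniteIndex' := Subgroup.finiteIndex_iInf fun p =>
    (N.comap (place (k + m) p.val (by omega))).isFiniteIndex'

/-- The subgroup of `PB` on `k + 1` strands induced by a subgroup `N` on `k + 2` strands: the pure
braids which are mapped to `N` by each doubling of a strand and by adding a trivial strand
on the right or on the left. -/
def pull (k : ℕ) (N : FiniteIndexNormalSubgroup (Br (k + 1))) : FiniteIndexNormalSubgroup (Br k) :=
  FiniteIndexNormalSubgroup.ofSubgroup (crossedPull (perm k) dbl dbl_mul N.toSubgroup) ⊓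
    (N.comap (place (k + 1) 0 (by omega)) ⊓ N.comap (place (k + 1) 1 (by omega)))

end Br

/-- The poset of finite index normal subgroups of the braid group on 4 strands which are contained
in the pure braid group. -/
abbrev NFI : Type := {N : FiniteIndexNormalSubgroup (Br 3) // N.toSubgroup ≤ Br.PB 3}

namespace NFI

/-- The family of subgroups of the braid groups induced by `N`: on 4 strands this is `N` itself, on
3 strands it is `N_{PB_3}` and on 2 strands it is `N_{PB_2}`.  (On one strand the braid group is
trivial, and the values on more than 4 strands play no role.) -/
def level (N : NFI) : (k : ℕ) → FiniteIndexNormalSubgroup (Br k)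
  | 0 => Br.pull 0 (Br.pull 1 (Br.pull 2 N.1))
  | 1 => Br.pull 1 (Br.pull 2 N.1)
  | 2 => Br.pull 2 N.1
  | 3 => N.1
  | k + 4 => FiniteIndexNormalSubgroup.ofSubgroup (Br.PB (k + 4))

theorem level_le (N : NFI) (k : ℕ) {g : Br k} (hg : g ∈ N.level k) : Br.perm k g = 1 := by
  match k with
  | 0 => exact hg.1.1
  | 1 => exact hg.1.1
  | 2 => exact hg.1.1
  | 3 => exact N.2 hg
  | k + 4 => exact hg

theorem dbl_mem_level (N : NFI) (k : ℕ) {g : Br k} (hg : g ∈ N.level k) (p : Fin (k + 1)) :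
    Br.dbl p g ∈ N.level (k + 1) := by
  have key : Br.perm k g = 1 → Br.perm (k + 1) (Br.dbl p g) = 1 := fun h => by
    rw [Br.perm_dbl, h, permIns_one]
  match k with
  | 0 => exact hg.1.2 p
  | 1 => exact hg.1.2 p
  | 2 => exact hg.1.2 p
  | 3 => exact key (N.2 hg)
  | k + 4 => exact key hg

theorem perm_place_eq_one {m : ℕ} (n p : ℕ) (hp : p + m ≤ n) {g : Br m} (hg : Br.perm m g = 1) :
    Br.perm n (Br.place n p hp g) = 1 := by
  obtain ⟨k, rfl⟩ : ∃ k, n = k + m := ⟨n - m, by omega⟩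
  have := Br.perm_place (⟨p, by omega⟩ : Fin (k + 1)) g
  rw [hg, permIns_one] at this
  exact this

theorem place_mem_level (N : NFI) (m : ℕ) {g : Br m} (hg : g ∈ N.level m) (n p : ℕ)
    (hp : p + m ≤ n) : Br.place n p hp g ∈ N.level n := by
  have step : ∀ (k : ℕ) (h : Br k), h ∈ N.level k →
      Br.place (k + 1) 0 (by omega) h ∈ N.level (k + 1) ∧
      Br.place (k + 1) 1 (by omega) h ∈ N.level (k + 1) := by
    intro k h hh
    match k with
    | 0 => exact hh.2
    | 1 => exact hh.2
    | 2 => exact hh.2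
    | 3 => exact ⟨perm_place_eq_one _ _ _ (N.2 hh), perm_place_eq_one _ _ _ (N.2 hh)⟩
    | k + 4 => exact ⟨perm_place_eq_one _ _ _ hh, perm_place_eq_one _ _ _ hh⟩
  induction n generalizing p with
  | zero =>
    obtain rfl : m = 0 := by omega
    obtain rfl : p = 0 := by omega
    rwa [Br.place_self]
  | succ n ih =>
    rcases Nat.lt_or_ge n (p + m) with h | h
    · rcases Nat.eq_zero_or_pos p with h0 | h0
      · subst h0
        obtain rfl : m = n + 1 := by omega
        rwa [Br.place_self]
      · have := (step n _ (ih (p - 1) (by omega) step)).2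
        rw [Br.place_place] at this
        convert this using 3
        omega
    · have := (step n _ (ih p h step)).1
      rw [Br.place_place] at this
      convert this using 3
      omega

theorem cab_mem_level (N : NFI) (k m : ℕ) {g : Br k} (hg : g ∈ N.level k) (p : Fin (k + 1)) :
    Br.cab m p g ∈ N.level (k + m) := by
  induction m with
  | zero => exact hg
  | succ m ih => exact N.dbl_mem_level (k + m) ih _

theorem level_le_cabPull (N : NFI) (k m : ℕ) :
    N.level k ≤ Br.cabPull k m (N.level (k + m)) :=
  fun _ hg => ⟨N.level_le k hg, fun p => N.cab_mem_level k m hg p⟩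

theorem level_le_placePull (N : NFI) (k m : ℕ) :
    N.level m ≤ Br.placePull k m (N.level (k + m)) := by
  intro g hg
  refine (Subgroup.mem_iInf).mpr fun p => ?_
  exact N.place_mem_level m hg _ _ _

end NFI

namespace Br

/-- Insertion of braids descends to the quotients by normal subgroups which are compatible
with cabling and placement. -/
def insQuot {k m : ℕ} (K : FiniteIndexNormalSubgroup (Br k)) (L : FiniteIndexNormalSubgroup (Br m))
    (N : FiniteIndexNormalSubgroup (Br (k + m))) (hK : K ≤ cabPull k m N) (hL : L ≤ placePull k m N)
    (p : Fin (k + 1)) : Br k ⧸ K.toSubgroup → Br m ⧸ L.toSubgroup → Br (k + m) ⧸ N.toSubgroup :=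
  Quotient.map₂ (ins p) (by
    intro g g' hg h h' hh
    have hg : g⁻¹ * g' ∈ K := QuotientGroup.leftRel_apply.mp hg
    have hh : h⁻¹ * h' ∈ L := QuotientGroup.leftRel_apply.mp hh
    obtain ⟨x, rfl⟩ : ∃ x, g' = g * x := ⟨g⁻¹ * g', by group⟩
    obtain ⟨y, rfl⟩ : ∃ y, h' = h * y := ⟨h⁻¹ * h', by group⟩
    rw [inv_mul_cancel_left] at hg hh
    obtain ⟨hx, hx'⟩ := hK hg
    have hy := Subgroup.mem_iInf.mp (hL hh) p
    refine QuotientGroup.leftRel_apply.mpr ?_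
    have e : (ins p g h)⁻¹ * ins p (g * x) (h * y) =
        (place (k + m) p.val (by omega) h)⁻¹ * cab m p x * (place (k + m) p.val (by omega) h)⁻¹⁻¹ *
          place (k + m) p.val (by omega) y := by
      rw [ins, ins, cab_mul, hx, Equiv.Perm.one_apply, map_mul]
      group
    rw [e]
    exact N.toSubgroup.mul_mem (N.isNormal'.conj_mem _ (hx' p) _) hy)

theorem insQuot_mk {k m : ℕ} (K : FiniteIndexNormalSubgroup (Br k))
    (L : FiniteIndexNormalSubgroup (Br m)) (N : FiniteIndexNormalSubgroup (Br (k + m)))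
    (hK : K ≤ cabPull k m N) (hL : L ≤ placePull k m N) (p : Fin (k + 1)) (g : Br k) (h : Br m) :
    insQuot K L N hK hL p (g : Br k ⧸ K.toSubgroup) (h : Br m ⧸ L.toSubgroup) =
      (ins p g h : Br (k + m) ⧸ N.toSubgroup) := rfl

/-- The permutation of an element of a quotient of the braid group by a group of pure braids. -/
def permQuot {k : ℕ} (K : FiniteIndexNormalSubgroup (Br k)) (hK : K.toSubgroup ≤ PB k) :
    Br k ⧸ K.toSubgroup →* Equiv.Perm (Fin (k + 1)) :=
  QuotientGroup.lift K.toSubgroup (perm k) fun _ h => hK h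

end Br

/-- Groups `G k` over the symmetric groups of `k + 1` letters, together with insertions: `ins p g h`
is the insertion of `h` into the strand of `g` which starts in position `p`.  These are the
data from which an operad of groupoids in the style of parenthesized braids is assembled. -/
structure StrandGroups where
  G : ℕ → Type
  [grp : ∀ k, Group (G k)]
  perm : ∀ k, G k →* Equiv.Perm (Fin (k + 1))
  ins : ∀ {k m : ℕ}, Fin (k + 1) → G k → G m → G (k + m)
  perm_ins : ∀ {k m : ℕ} (p : Fin (k + 1)) (g : G k) (h : G m),
    perm (k + m) (ins p g h) = permIns p (perm k g) (perm m h)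

attribute [instance] StrandGroups.grp

/-- The braid groups. -/
def braids : StrandGroups where
  G := Br
  perm := Br.perm
  ins := Br.ins
  perm_ins := Br.perm_ins

/-- The quotients of the braid groups by the subgroups induced by `N`. -/
def braidsMod (N : NFI) : StrandGroups where
  G k := Br k ⧸ (N.level k).toSubgroup
  perm k := Br.permQuot (N.level k) fun _ => N.level_le k
  ins {k m} := Br.insQuot (N.level k) (N.level m) (N.level (k + m)) (N.level_le_cabPull k m)
    (N.level_le_placePull k m)
  perm_ins {k m} p g h := by
    induction g using QuotientGroup.induction_on with | H g => ?_
    induction h using QuotientGroup.induction_on with | H h => ?_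
    exact Br.perm_ins p g h

/-- The profinite completion of the braid group on `k + 1` strands. -/
abbrev BrHat (k : ℕ) : Type := ProfiniteGrp.ProfiniteCompletion.completion (GrpCat.of (Br k))

namespace BrHat

/-- The component of an element of the profinite completion in a finite quotient. -/
def proj {k : ℕ} (N : FiniteIndexNormalSubgroup (Br k)) : BrHat k →* Br k ⧸ N.toSubgroup where
  toFun x := x.val N
  map_one' := rfl
  map_mul' _ _ := rfl

/-- The canonical homomorphism from the braid group to its profinite completion. -/
def eta (k : ℕ) : Br k →* BrHat k :=
  (ProfiniteGrp.ProfiniteCompletion.eta (GrpCat.of (Br k))).hom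

theorem proj_eta {k : ℕ} (N : FiniteIndexNormalSubgroup (Br k)) (g : Br k) :
    proj N (eta k g) = (g : Br k ⧸ N.toSubgroup) := rfl

theorem map_proj {k : ℕ} (x : BrHat k) {N N' : FiniteIndexNormalSubgroup (Br k)} (h : N ≤ N') :
    QuotientGroup.map N.toSubgroup N'.toSubgroup (MonoidHom.id _) h (proj N x) = proj N' x :=
  x.property (homOfLE h)

theorem ext {k : ℕ} {x y : BrHat k} (h : ∀ N, proj N x = proj N y) : x = y :=
  Subtype.ext (funext h)

theorem proj_eq_of_le {k : ℕ} (x : BrHat k) {N N' : FiniteIndexNormalSubgroup (Br k)} (h : N ≤ N')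
    {g : Br k} (hg : proj N x = (g : Br k ⧸ N.toSubgroup)) :
    proj N' x = (g : Br k ⧸ N'.toSubgroup) := by
  rw [← map_proj x h, hg]; rfl

/-- The permutation of an element of the completed braid group. -/
def perm (k : ℕ) : BrHat k →* Equiv.Perm (Fin (k + 1)) :=
  (Br.permQuot (FiniteIndexNormalSubgroup.ofSubgroup (Br.PB k)) le_rfl).comp (proj _)

theorem perm_eq {k : ℕ} (x : BrHat k) (N : FiniteIndexNormalSubgroup (Br k))
    (hN : N.toSubgroup ≤ Br.PB k) : perm k x = Br.permQuot N hN (proj N x) := by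
  obtain ⟨g, hg⟩ := QuotientGroup.mk_surjective (proj N x)
  have := proj_eq_of_le (N' := FiniteIndexNormalSubgroup.ofSubgroup (Br.PB k)) x hN hg.symm
  rw [perm, MonoidHom.comp_apply, this, ← hg]
  rfl

/-- The extension of the insertion of braids to the profinite completions. -/
def ins {k m : ℕ} (p : Fin (k + 1)) (x : BrHat k) (y : BrHat m) : BrHat (k + m) :=
  ⟨fun N => Br.insQuot (Br.cabPull k m N) (Br.placePull k m N) N le_rfl le_rfl p
    (proj (Br.cabPull k m N) x) (proj (Br.placePull k m N) y), by
    intro N N' f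
    have h : N ≤ N' := leOfHom f
    have hK : Br.cabPull k m N ≤ Br.cabPull k m N' := fun g hg => ⟨hg.1, fun p => h (hg.2 p)⟩
    have hL : Br.placePull k m N ≤ Br.placePull k m N' := fun g hg =>
      Subgroup.mem_iInf.mpr fun q => h (Subgroup.mem_iInf.mp hg q)
    obtain ⟨g, hg⟩ := QuotientGroup.mk_surjective (proj (Br.cabPull k m N) x)
    obtain ⟨e, he⟩ := QuotientGroup.mk_surjective (proj (Br.placePull k m N) y)
    change QuotientGroup.map N.toSubgroup N'.toSubgroup (MonoidHom.id _) h
      (Br.insQuot (Br.cabPull k m N) (Br.placePull k m N) N le_rfl le_rfl p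
        (proj (Br.cabPull k m N) x) (proj (Br.placePull k m N) y)) =
      Br.insQuot (Br.cabPull k m N') (Br.placePull k m N') N' le_rfl le_rfl p
        (proj (Br.cabPull k m N') x) (proj (Br.placePull k m N') y)
    rw [proj_eq_of_le x hK hg.symm, proj_eq_of_le y hL he.symm, ← hg, ← he]
    rfl⟩

theorem proj_ins {k m : ℕ} (p : Fin (k + 1)) (x : BrHat k) (y : BrHat m)
    {K : FiniteIndexNormalSubgroup (Br k)} {L : FiniteIndexNormalSubgroup (Br m)}
    {N : FiniteIndexNormalSubgroup (Br (k + m))} (hK : K ≤ Br.cabPull k m N)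
    (hL : L ≤ Br.placePull k m N) :
    proj N (ins p x y) = Br.insQuot K L N hK hL p (proj K x) (proj L y) := by
  obtain ⟨g, hg⟩ := QuotientGroup.mk_surjective (proj K x)
  obtain ⟨e, he⟩ := QuotientGroup.mk_surjective (proj L y)
  change Br.insQuot _ _ N le_rfl le_rfl p (proj _ x) (proj _ y) = _
  rw [proj_eq_of_le x hK hg.symm, proj_eq_of_le y hL he.symm, ← hg, ← he]
  rfl

theorem ins_eta {k m : ℕ} (p : Fin (k + 1)) (g : Br k) (h : Br m) :
    ins p (eta k g) (eta m h) = eta (k + m) (Br.ins p g h) := rfl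

theorem perm_ins {k m : ℕ} (p : Fin (k + 1)) (x : BrHat k) (y : BrHat m) :
    perm (k + m) (ins p x y) = permIns p (perm k x) (perm m y) := by
  let N := FiniteIndexNormalSubgroup.ofSubgroup (Br.PB (k + m))
  let K := Br.cabPull k m N
  let L := Br.placePull k m N ⊓ FiniteIndexNormalSubgroup.ofSubgroup (Br.PB m)
  have hK : K.toSubgroup ≤ Br.PB k := fun g hg => hg.1
  have hL : L.toSubgroup ≤ Br.PB m := fun g hg => hg.2
  rw [perm_eq x K hK, perm_eq y L hL, perm_eq _ N le_rfl,
    proj_ins p x y (K := K) (L := L) le_rfl inf_le_left]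
  obtain ⟨g, hg⟩ := QuotientGroup.mk_surjective (proj K x)
  obtain ⟨e, he⟩ := QuotientGroup.mk_surjective (proj L y)
  rw [← hg, ← he]
  exact Br.perm_ins p g e

end BrHat

/-- The profinite completions of the braid groups. -/
def braidsHat : StrandGroups where
  G k := BrHat k
  perm := BrHat.perm
  ins := BrHat.ins
  perm_ins := BrHat.perm_ins

/-- Objects of the groupoid of parenthesized braids on `k + 1` strands: completely parenthesized
sequences of `k + 1` labels in which every label appears exactly once.  The parenthesization is
a binary tree with `k` inner nodes (hence `k + 1` leaves), and `label p` is the label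
in position `p`. -/
@[ext]
structure PaObj (k : ℕ) where
  shape : BinaryTree Unit
  numNodes_shape : shape.numNodes = k
  label : Equiv.Perm (Fin (k + 1))

/-- `graft t p s` is the tree `t` with the tree `s` grafted onto the leaf in position `p`. -/
def graft : BinaryTree Unit → ℕ → BinaryTree Unit → BinaryTree Unit
  | .nil, _, s => s
  | .node _ l r, p, s =>
    if p < l.numLeaves then .node () (graft l p s) r else .node () l (graft r (p - l.numLeaves) s)

theorem numNodes_graft (t : BinaryTree Unit) (p : ℕ) (s : BinaryTree Unit) :
    (graft t p s).numNodes = t.numNodes + s.numNodes := by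
  induction t generalizing p with
  | nil => simp [graft]
  | node _ l r hl hr =>
    rw [graft]
    split_ifs
    · simp [hl]; omega
    · simp [hr]; omega

namespace PaObj

/-- The action of the symmetric group on objects: relabelling. -/
def relabel {k : ℕ} (τ : Equiv.Perm (Fin (k + 1))) (w : PaObj k) : PaObj k where
  shape := w.shape
  numNodes_shape := w.numNodes_shape
  label := τ * w.label

/-- The elementary insertion of objects: `v` is inserted in place of the label `i` of `w`.  The
labels of `v` become `i, …, i + m`, and the labels of `w` which are larger than `i` are
shifted by `m`. -/
def ins {k m : ℕ} (w : PaObj k) (i : Fin (k + 1)) (v : PaObj m) : PaObj (k + m) where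
  shape := graft w.shape (w.label.symm i).val v.shape
  numNodes_shape := by rw [numNodes_graft, w.numNodes_shape, v.numNodes_shape]
  label := permIns (w.label.symm i) w.label v.label

/-- The object `((1,2)3)4` with the labels numbered from `0`. -/
def std4 : PaObj 3 where
  shape := .node () (.node () (.node () .nil .nil) .nil) .nil
  numNodes_shape := rfl
  label := 1

end PaObj

namespace StrandGroups

/-- Morphisms from `w` to `w'` in the groupoid of arity `k + 1` assembled from the groups `S`: the
elements whose permutation carries each label of `w` to the same label of `w'`. For the braid
groups these are the morphisms of parenthesized braids. -/
def Hom (S : StrandGroups) {k : ℕ} (w w' : PaObj k) : Type :=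
  {g : S.G k // w'.label * S.perm k g = w.label}

namespace Hom

variable {S : StrandGroups} {k m : ℕ}

/-- Identity morphisms. -/
def id (w : PaObj k) : S.Hom w w := ⟨1, by rw [map_one, mul_one]⟩

/-- Composition of morphisms: first `f`, then `g`. -/
def comp {w w' w'' : PaObj k} (g : S.Hom w' w'') (f : S.Hom w w') : S.Hom w w'' :=
  ⟨g.1 * f.1, by rw [map_mul, ← mul_assoc, g.2, f.2]⟩

/-- The action of the symmetric group on morphisms. -/
def relabel (τ : Equiv.Perm (Fin (k + 1))) {w w' : PaObj k} (f : S.Hom w w') :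
    S.Hom (w.relabel τ) (w'.relabel τ) :=
  ⟨f.1, by simp only [PaObj.relabel]; rw [mul_assoc, f.2]⟩

/-- The elementary insertions of morphisms. -/
def ins {w w' : PaObj k} (f : S.Hom w w') (i : Fin (k + 1)) {v v' : PaObj m} (g : S.Hom v v') :
    S.Hom (w.ins i v) (w'.ins i v') :=
  ⟨S.ins (w.label.symm i) f.1 g.1, by
    have h : w'.label.symm i = S.perm k f.1 (w.label.symm i) := by
      rw [Equiv.symm_apply_eq, ← Equiv.Perm.mul_apply, f.2, Equiv.apply_symm_apply]
    simp only [PaObj.ins]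
    rw [S.perm_ins, h, permIns_mul, f.2, g.2]⟩

end Hom

/-- Morphisms of 4-truncated operads of groupoids (arities 1, 2, 3, 4), which are the identity
on objects: functors which commute with the symmetric groups and with all elementary insertions
of total arity at most 4. -/
@[ext]
structure TruncMor (S T : StrandGroups) where
  app : ∀ (k : ℕ), k ≤ 3 → ∀ {w w' : PaObj k}, S.Hom w w' → T.Hom w w'
  app_id : ∀ (k : ℕ) (hk : k ≤ 3) (w : PaObj k), app k hk (Hom.id (S := S) w) = Hom.id w
  app_comp : ∀ (k : ℕ) (hk : k ≤ 3) {w w' w'' : PaObj k} (g : S.Hom w' w'') (f : S.Hom w w'),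
    app k hk (g.comp f) = (app k hk g).comp (app k hk f)
  app_relabel : ∀ (k : ℕ) (hk : k ≤ 3) (τ : Equiv.Perm (Fin (k + 1))) {w w' : PaObj k}
    (f : S.Hom w w'), app k hk (f.relabel τ) = (app k hk f).relabel τ
  app_ins : ∀ (k m : ℕ) (hkm : k + m ≤ 3) {w w' : PaObj k} (f : S.Hom w w') (i : Fin (k + 1))
    {v v' : PaObj m} (g : S.Hom v v'),
    app (k + m) hkm (f.ins i g) = (app k (by omega) f).ins i (app m (by omega) g)

/-- The category of the 4-truncated operads assembled from strand groups. -/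
instance : Category StrandGroups where
  Hom := TruncMor
  id S :=
    { app := fun _ _ _ _ f => f
      app_id := fun _ _ _ => rfl
      app_comp := fun _ _ _ _ _ _ _ => rfl
      app_relabel := fun _ _ _ _ _ _ => rfl
      app_ins := fun _ _ _ _ _ _ _ _ _ _ => rfl }
  comp F F' :=
    { app := fun k hk _ _ f => F'.app k hk (F.app k hk f)
      app_id := fun k hk w => by rw [F.app_id, F'.app_id]
      app_comp := fun k hk _ _ _ g f => by rw [F.app_comp, F'.app_comp]
      app_relabel := fun k hk τ _ _ f => by rw [F.app_relabel, F'.app_relabel]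
      app_ins := fun k m hkm _ _ f i _ _ g => by rw [F.app_ins, F'.app_ins] }

end StrandGroups

open StrandGroups

/-- The topology on the morphisms of the profinite completion of parenthesized braids. -/
instance {k : ℕ} (w w' : PaObj k) : TopologicalSpace (braidsHat.Hom w w') :=
  inferInstanceAs (TopologicalSpace {g : BrHat k // w'.label * BrHat.perm k g = w.label})

/-- The group of continuous automorphisms (identical on objects) of the profinite completion of the
operad of parenthesized braids, in all arities, with composition as the product. -/
def GTHat : Subgroup (∀ (k : ℕ) (w w' : PaObj k), Equiv.Perm (braidsHat.Hom w w')) where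
  carrier := {T |
    (∀ (k : ℕ) (w w' w'' : PaObj k) (g : braidsHat.Hom w' w'') (f : braidsHat.Hom w w'),
      T k w w'' (g.comp f) = (T k w' w'' g).comp (T k w w' f)) ∧
    (∀ (k : ℕ) (w w' : PaObj k) (τ : Equiv.Perm (Fin (k + 1))) (f : braidsHat.Hom w w'),
      T k (w.relabel τ) (w'.relabel τ) (f.relabel τ) = (T k w w' f).relabel τ) ∧
    (∀ (k m : ℕ) (w w' : PaObj k) (v v' : PaObj m) (i : Fin (k + 1)) (f : braidsHat.Hom w w')
      (g : braidsHat.Hom v v'),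
      T (k + m) (w.ins i v) (w'.ins i v') (f.ins i g) = (T k w w' f).ins i (T m v v' g)) ∧
    (∀ (k : ℕ) (w w' : PaObj k), Continuous (T k w w') ∧ Continuous (T k w w').symm)}
  one_mem' := ⟨fun _ _ _ _ _ _ => rfl, fun _ _ _ _ _ => rfl, fun _ _ _ _ _ _ _ _ _ => rfl,
    fun _ _ _ => ⟨continuous_id, continuous_id⟩⟩
  mul_mem' := by
    rintro T U ⟨h1, h2, h3, h4⟩ ⟨h1', h2', h3', h4'⟩
    refine ⟨fun k w w' w'' g f => ?_, fun k w w' τ f => ?_, fun k m w w' v v' i f g => ?_,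
      fun k w w' => ⟨(h4 k w w').1.comp (h4' k w w').1, (h4' k w w').2.comp (h4 k w w').2⟩⟩
    · simp only [Pi.mul_apply, Equiv.Perm.mul_apply, h1', h1]
    · simp only [Pi.mul_apply, Equiv.Perm.mul_apply, h2', h2]
    · simp only [Pi.mul_apply, Equiv.Perm.mul_apply, h3', h3]
  inv_mem' := by
    rintro T ⟨h1, h2, h3, h4⟩
    have key : ∀ (k : ℕ) (w w' : PaObj k) (f : braidsHat.Hom w w'),
        T k w w' ((T k w w')⁻¹ f) = f := fun k w w' f => (T k w w').apply_symm_apply f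
    refine ⟨fun k w w' w'' g f => ?_, fun k w w' τ f => ?_, fun k m w w' v v' i f g => ?_,
      fun k w w' => ⟨(h4 k w w').2, (h4 k w w').1⟩⟩
    · simp only [Pi.inv_apply, Equiv.Perm.inv_eq_iff_eq, h1, key]
    · simp only [Pi.inv_apply, Equiv.Perm.inv_eq_iff_eq, h2, key]
    · simp only [Pi.inv_apply, Equiv.Perm.inv_eq_iff_eq, h3, key]

/-- The restriction of an element of `GTHat` to the 4-truncated operad. -/
def GTHat.trunc (T : GTHat) : braidsHat ⟶ braidsHat where
  app k _ w w' f := T.1 k w w' f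
  app_id k _ w := by
    have h := T.2.1 k w w w (Hom.id w) (Hom.id w)
    have e : (Hom.id (S := braidsHat) w).comp (Hom.id w) = Hom.id w := Subtype.ext (mul_one _)
    rw [e] at h
    refine Subtype.ext ?_
    exact left_eq_mul.mp (congrArg Subtype.val h)
  app_comp k _ _ _ _ g f := T.2.1 k _ _ _ g f
  app_relabel k _ τ _ _ f := T.2.2.1 k _ _ τ f
  app_ins k m _ _ _ f i _ _ g := T.2.2.2.1 k m _ _ _ _ i f g

/-- The canonical morphism from parenthesized braids to their profinite completion. -/
def canI : braids ⟶ braidsHat where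
  app k _ _ _ f := ⟨BrHat.eta k f.1, f.2⟩
  app_id k _ _ := Subtype.ext (map_one (BrHat.eta k))
  app_comp k _ _ _ _ g f := Subtype.ext (map_mul (BrHat.eta k) g.1 f.1)
  app_relabel _ _ _ _ _ _ := rfl
  app_ins _ _ _ _ _ _ _ _ _ _ := rfl

/-- The canonical projection from parenthesized braids to their quotient by `N`. -/
def projMod (N : NFI) : braids ⟶ braidsMod N where
  app k _ _ _ f := ⟨QuotientGroup.mk (s := (N.level k).toSubgroup) f.1, f.2⟩
  app_id _ _ _ := rfl
  app_comp _ _ _ _ _ _ _ := rfl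
  app_relabel _ _ _ _ _ _ := rfl
  app_ins _ _ _ _ _ _ _ _ _ _ := rfl

/-- The canonical projection from the profinite completion of parenthesized braids to the quotient
of parenthesized braids by `N`. -/
def projHat (N : NFI) : braidsHat ⟶ braidsMod N where
  app k _ w w' f := ⟨BrHat.proj (N.level k) f.1, by
    refine Eq.trans ?_ f.2
    exact congrArg (w'.label * ·) (BrHat.perm_eq f.1 (N.level k) fun _ => N.level_le k).symm⟩
  app_id k _ _ := Subtype.ext (map_one (BrHat.proj (N.level k)))
  app_comp k _ _ _ _ g f := Subtype.ext (map_mul (BrHat.proj (N.level k)) g.1 f.1)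
  app_relabel _ _ _ _ _ _ := rfl
  app_ins k m _ _ _ f i _ _ g := Subtype.ext
    (BrHat.proj_ins _ f.1 g.1 (N.level_le_cabPull k m) (N.level_le_placePull k m))

/-- The morphism `T_N`, the composite of the canonical morphism to the completion, the automorphism
`T` and the projection to the quotient by `N`. -/
def GTHat.shadow (T : GTHat) (N : NFI) : braids ⟶ braidsMod N := canI ≫ GTHat.trunc T ≫ projHat N

/-- A GT-shadow with the target `N` is a morphism of truncated operads from parenthesized braids to
their quotient by `N` which is onto. -/
def IsGTShadow {N : NFI} (F : braids ⟶ braidsMod N) : Prop :=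
  ∀ (k : ℕ) (hk : k ≤ 3) (w w' : PaObj k),
    Function.Surjective (TruncMor.app F k hk : braids.Hom w w' → (braidsMod N).Hom w w')

/-- The homomorphism from the pure braid group on 4 strands, which is the automorphism group of the
object `((1,2)3)4`, to its quotient by `N` (as a subgroup of the quotient of the braid
group by `N`), given by a morphism of truncated operads. -/
def onPB4 {N : NFI} (F : braids ⟶ braidsMod N) : Br.PB 3 →* Br 3 ⧸ N.1.toSubgroup where
  toFun g := (TruncMor.app F 3 le_rfl (w := PaObj.std4) (w' := PaObj.std4)
    ⟨g.1, by rw [show braids.perm 3 g.1 = 1 from g.2, mul_one]⟩).1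
  map_one' := congrArg Subtype.val (TruncMor.app_id F 3 le_rfl PaObj.std4)
  map_mul' g h := congrArg Subtype.val (TruncMor.app_comp F 3 le_rfl
    (⟨g.1, by rw [show braids.perm 3 g.1 = 1 from g.2, mul_one]⟩ :
      braids.Hom PaObj.std4 PaObj.std4)
    (⟨h.1, by rw [show braids.perm 3 h.1 = 1 from h.2, mul_one]⟩))

/-- The kernel of `onPB4`, as a subgroup of the braid group. -/
def kerPB4 {N : NFI} (F : braids ⟶ braidsMod N) : Subgroup (Br 3) :=
  (onPB4 F).ker.map (Br.PB 3).subtype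

/-- The groupoid of GT-shadows.  Its objects are the elements of `NFI`. -/
structure GTSh where
  obj : NFI

/-- Morphisms from `K` to `N` are the isomorphisms of truncated operads from the quotient of
parenthesized braids by `K` to the quotient by `N`; such an isomorphism corresponds to the
GT-shadow with the target `N` that is its composite with the projection to the
quotient by `K`. -/
instance : Groupoid GTSh where
  Hom K N := braidsMod K.obj ≅ braidsMod N.obj
  id _ := Iso.refl _
  comp f g := f ≪≫ g
  inv f := f.symm
  id_comp f := Iso.ext (Category.id_comp (Iso.hom f))
  comp_id f := Iso.ext (Category.comp_id (Iso.hom f))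
  assoc f g h := Iso.ext (Category.assoc (Iso.hom f) (Iso.hom g) (Iso.hom h))
  inv_comp f := Iso.ext (Iso.inv_hom_id f)
  comp_inv f := Iso.ext (Iso.hom_inv_id f)

/-- The GT-shadow with the target `N` which corresponds to a morphism of `GTSh`. -/
def GTSh.toShadow {K N : GTSh} (f : K ⟶ N) : braids ⟶ braidsMod N.obj :=
  projMod K.obj ≫ Iso.hom (X := braidsMod K.obj) (Y := braidsMod N.obj) f

/-- The objects of the transformation groupoid of a right action of `G` on `X`. -/
@[ext]
structure TransformationGroupoid (G X : Type) [Group G] [MulAction Gᵐᵒᵖ X] where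
  pt : X

/-- The transformation groupoid of a right action: morphisms from `x` to `y` are the
elements `g` with `y ^ g = x`, and the composite of `h : x ⟶ y` and `g : y ⟶ z` is `g * h`. -/
instance (G X : Type) [Group G] [MulAction Gᵐᵒᵖ X] : Groupoid (TransformationGroupoid G X) where
  Hom x y := {g : G // MulOpposite.op g • y.pt = x.pt}
  id x := ⟨1, one_smul _ _⟩
  comp h g := ⟨g.1 * h.1, by rw [MulOpposite.op_mul, mul_smul, g.2, h.2]⟩
  inv g := ⟨g.1⁻¹, by rw [MulOpposite.op_inv, inv_smul_eq_iff, g.2]⟩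
  id_comp _ := Subtype.ext (mul_one _)
  comp_id _ := Subtype.ext (one_mul _)
  assoc _ _ _ := Subtype.ext (mul_assoc _ _ _).symm
  inv_comp _ := Subtype.ext (mul_inv_cancel _)
  comp_inv _ := Subtype.ext (inv_mul_cancel _)

/-- The element of `G` underlying a morphism of the transformation groupoid. -/
def TransformationGroupoid.elt {G X : Type} [Group G] [MulAction Gᵐᵒᵖ X]
    {x y : TransformationGroupoid G X} (f : x ⟶ y) : G := f.1

/-! The argument is a first isomorphism theorem for truncated operads combined with density of
braids in their profinite completion.

A morphism `F` out of the parenthesized braids is controlled by its kernels `pureKer F k`, one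
normal subgroup of the braid group for each arity. Two parallel morphisms have the same image
exactly when they differ by an element of the kernel (`app_eq_iff`), and membership in the kernel
can be tested at a single object, because objects with equal labels are joined by the trivial braid
and `F` commutes with relabelling. In particular `kerPB4 F` is the whole arity 4 kernel, which makes
it normal in the full braid group; it has finite index because its target is finite. Since `F`
commutes with inserting into and inserting identities, a pure braid is killed by `F` exactly when
its doublings and its extensions by a trivial strand are killed. This is the recipe that produces
the lower subgroups from `N`, so all kernels are induced by the one in arity 4 (`pureKer_eq_level`).
Hence an `F` that is onto the quotient by `N` is the projection modulo its kernel `K`, followed by a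
unique isomorphism from the quotient by `K` to the quotient by `N` (`exists_iso_of_kerPB4_eq`).

On the profinite side, the projection to a finite quotient has open fibres, and so does its
composite with a continuous automorphism. Every nonempty open set of morphisms contains a braid.
Therefore each `T_N` is onto, and the identity `T_N` = (projection modulo `K`) followed by the
isomorphism extends from braids to the completion (`trunc_projHat`). So `T` descends to the
quotients. Pasting the squares of `T` and `U` gives `shadow_mul`. As an isomorphism does not change
kernels, this yields the right action, and cancelling the onto projection yields functoriality. -/

namespace StrandGroups

/-! ### Quotients of truncated operads: factoring through a morphism that is onto -/

theorem Hom.ext {S : StrandGroups} {k : ℕ} {w w' : PaObj k} {f g : S.Hom w w'} (h : f.1 = g.1) :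
    f = g := Subtype.ext h

/-- A morphism of truncated operads is onto if it is onto on all sets of morphisms. -/
def IsOnto {S T : StrandGroups} (F : S ⟶ T) : Prop :=
  ∀ (k : ℕ) (hk : k ≤ 3) (w w' : PaObj k),
    Function.Surjective (TruncMor.app F k hk : S.Hom w w' → T.Hom w w')

theorem truncMor_ext {S T : StrandGroups} {F G : S ⟶ T}
    (h : ∀ (k : ℕ) (hk : k ≤ 3) (w w' : PaObj k) (f : S.Hom w w'),
      TruncMor.app F k hk f = TruncMor.app G k hk f) : F = G := by
  refine TruncMor.ext ?_
  funext k hk w w' f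
  exact h k hk w w' f

theorem comp_app {S T U : StrandGroups} (F : S ⟶ T) (G : T ⟶ U) {k : ℕ} (hk : k ≤ 3)
    {w w' : PaObj k} (f : S.Hom w w') :
    TruncMor.app (F ≫ G) k hk f = TruncMor.app G k hk (TruncMor.app F k hk f) := rfl

theorem IsOnto.cancel {S T U : StrandGroups} {P : S ⟶ T} (hP : IsOnto P) {G H : T ⟶ U}
    (h : P ≫ G = P ≫ H) : G = H := by
  refine truncMor_ext fun k hk w w' f => ?_
  obtain ⟨e, rfl⟩ := hP k hk w w' f
  rw [← comp_app, h, comp_app]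

theorem IsOnto.exists_factor {S T U : StrandGroups} {P : S ⟶ T} (hP : IsOnto P) {F : S ⟶ U}
    (h : ∀ (k : ℕ) (hk : k ≤ 3) (w w' : PaObj k) (f f' : S.Hom w w'),
      TruncMor.app P k hk f = TruncMor.app P k hk f' →
        TruncMor.app F k hk f = TruncMor.app F k hk f') : ∃ G : T ⟶ U, P ≫ G = F := by
  -- The set-theoretic section `s` respects no structure. The composite of `F` with `s` does,
  -- because `F` takes the same value on all preimages of a given morphism under `P`.
  choose s hs using hP
  have key : ∀ (k : ℕ) (hk : k ≤ 3) (w w' : PaObj k) (f : S.Hom w w'),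
      TruncMor.app F k hk (s k hk w w' (TruncMor.app P k hk f)) = TruncMor.app F k hk f :=
    fun k hk w w' f => h k hk w w' _ _ (hs k hk w w' _)
  have key' : ∀ (k : ℕ) (hk : k ≤ 3) (w w' : PaObj k) (f : S.Hom w w') (g : T.Hom w w'),
      TruncMor.app P k hk f = g →
      TruncMor.app F k hk (s k hk w w' g) = TruncMor.app F k hk f := by
    rintro k hk w w' f _ rfl
    exact key k hk w w' f
  let G : TruncMor T U :=
    { app := fun k hk w w' f => TruncMor.app F k hk (s k hk w w' f)
      app_id := fun k hk w => by
        rw [key' k hk w w (Hom.id w) _ (TruncMor.app_id P k hk w)]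
        exact TruncMor.app_id F k hk w
      app_comp := fun k hk w w' w'' g f => by
        rw [key' k hk w w'' ((s k hk w' w'' g).comp (s k hk w w' f)) _ (by
          rw [TruncMor.app_comp, hs, hs])]
        exact TruncMor.app_comp F k hk _ _
      app_relabel := fun k hk τ w w' f => by
        rw [key' k hk _ _ ((s k hk w w' f).relabel τ) _ (by rw [TruncMor.app_relabel, hs])]
        exact TruncMor.app_relabel F k hk τ _
      app_ins := fun k m hkm w w' f i v v' g => by
        rw [key' (k + m) hkm _ _
          ((s k (by omega) w w' f).ins i (s m (by omega) v v' g)) _ (by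
            rw [TruncMor.app_ins, hs, hs])]
        exact TruncMor.app_ins F k m hkm _ i _ }
  exact ⟨G, truncMor_ext fun k hk w w' f => key k hk w w' f⟩

/-- Equal fibres allow factoring in both directions, and the two factors are mutually inverse
because `P` and `F` can be cancelled. -/
theorem IsOnto.exists_iso {S T U : StrandGroups} {P : S ⟶ T} {F : S ⟶ U} (hP : IsOnto P)
    (hF : IsOnto F)
    (h : ∀ (k : ℕ) (hk : k ≤ 3) (w w' : PaObj k) (f f' : S.Hom w w'),
      TruncMor.app P k hk f = TruncMor.app P k hk f' ↔
        TruncMor.app F k hk f = TruncMor.app F k hk f') : ∃ e : T ≅ U, P ≫ e.hom = F := by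
  obtain ⟨G, hG⟩ := hP.exists_factor fun k hk w w' f f' => (h k hk w w' f f').mp
  obtain ⟨G', hG'⟩ := hF.exists_factor fun k hk w w' f f' => (h k hk w w' f f').mpr
  refine ⟨⟨G, G', hP.cancel ?_, hF.cancel ?_⟩, hG⟩
  · rw [← Category.assoc, hG, hG', Category.comp_id]
  · rw [← Category.assoc, hG', hG, Category.comp_id]

/-! ### The kernel of a morphism out of parenthesized braids, arity by arity -/

/-- The elements which are mapped to `1` by a morphism of truncated operads, as automorphisms of
the objects of the given arity. -/
def pureKer {T : StrandGroups} (F : braids ⟶ T) (k : ℕ) (hk : k ≤ 3) : Subgroup (Br k) where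
  carrier := {g | Br.perm k g = 1 ∧ ∀ (w : PaObj k) (h : w.label * braids.perm k g = w.label),
    (TruncMor.app F k hk (⟨g, h⟩ : braids.Hom w w)).1 = 1}
  one_mem' := ⟨map_one _, fun w _ => congrArg Subtype.val (TruncMor.app_id F k hk w)⟩
  mul_mem' := by
    rintro a b ⟨ha, ha'⟩ ⟨hb, hb'⟩
    refine ⟨by rw [map_mul, ha, hb, one_mul], fun w _ => ?_⟩
    have ea : w.label * braids.perm k a = w.label := mul_eq_left.mpr ha
    have eb : w.label * braids.perm k b = w.label := mul_eq_left.mpr hb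
    refine (congrArg Subtype.val (TruncMor.app_comp F k hk (⟨a, ea⟩ : braids.Hom w w)
      (⟨b, eb⟩ : braids.Hom w w))).trans ?_
    exact (congrArg₂ (· * ·) (ha' w ea) (hb' w eb)).trans (mul_one 1)
  inv_mem' := by
    rintro a ⟨ha, ha'⟩
    refine ⟨by rw [map_inv, ha, inv_one], fun w h => ?_⟩
    have ea : w.label * braids.perm k a = w.label := mul_eq_left.mpr ha
    have e1 := congrArg Subtype.val (TruncMor.app_comp F k hk (⟨a, ea⟩ : braids.Hom w w)
      (⟨a⁻¹, h⟩ : braids.Hom w w))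
    have e2 : Hom.comp (⟨a, ea⟩ : braids.Hom w w) (⟨a⁻¹, h⟩ : braids.Hom w w) = Hom.id w :=
      Hom.ext (mul_inv_cancel a)
    rw [e2, TruncMor.app_id] at e1
    change (1 : T.G k) = _ * _ at e1
    rw [ha' w ea, one_mul] at e1
    exact e1.symm

variable {T : StrandGroups} (F : braids ⟶ T) {k : ℕ} (hk : k ≤ 3)

/-- Once the image of `g` drops out, what remains is the image of `f.comp e`, an identity. The
inverse of `f` is passed as a separate morphism `e`. -/
theorem app_conj {w w' : PaObj k} (f : braids.Hom w w') (g : braids.Hom w w)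
    (e : braids.Hom w' w) (hef : f.1 * e.1 = 1) (hg : (TruncMor.app F k hk g).1 = 1) :
    (TruncMor.app F k hk (f.comp (g.comp e))).1 = 1 := by
  have e1 := congrArg Subtype.val (TruncMor.app_comp F k hk f e)
  have e2 : f.comp e = Hom.id w' := Hom.ext hef
  rw [e2, TruncMor.app_id] at e1
  rw [TruncMor.app_comp, TruncMor.app_comp]
  change _ * (_ * _) = (1 : T.G k)
  rw [hg, one_mul]
  exact e1.symm

instance pureKer_normal : (pureKer F k hk).Normal where
  conj_mem := by
    rintro g ⟨hg, hg'⟩ s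
    refine ⟨by rw [map_mul, map_mul, hg, mul_one, map_inv, mul_inv_cancel], fun w h => ?_⟩
    -- Since `s` need not be pure, it is a morphism into `w` from the object `w'` with permuted
    -- labels. The conjugate is thus a loop at `w` that runs through `w'`, where `g` is known to be
    -- killed.
    let w' : PaObj k := ⟨w.shape, w.numNodes_shape, w.label * Br.perm k s⟩
    have e1 : w.label * braids.perm k s = w'.label := rfl
    have e2 : w'.label * braids.perm k s⁻¹ = w.label :=
      (congrArg (w'.label * ·) (map_inv (Br.perm k) s)).trans (mul_inv_cancel_right _ _)
    have e3 : w'.label * braids.perm k g = w'.label := mul_eq_left.mpr hg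
    have := app_conj F hk (⟨s, e1⟩ : braids.Hom w' w) ⟨g, e3⟩ ⟨s⁻¹, e2⟩ (mul_inv_cancel s)
      (hg' w' e3)
    have e4 : (⟨s * g * s⁻¹, h⟩ : braids.Hom w w) =
        Hom.comp (⟨s, e1⟩ : braids.Hom w' w)
          (Hom.comp (⟨g, e3⟩ : braids.Hom w' w') (⟨s⁻¹, e2⟩ : braids.Hom w w')) :=
      Hom.ext (S := braids) (mul_assoc s g s⁻¹)
    rw [e4]
    exact this

/-- To lie in `pureKer` may be checked on a single object. -/
theorem mem_pureKer_of_app_eq_one {w : PaObj k} (g : braids.Hom w w)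
    (hg : (TruncMor.app F k hk g).1 = 1) : g.1 ∈ pureKer F k hk := by
  have hp : Br.perm k g.1 = 1 := mul_eq_left.mp g.2
  refine ⟨hp, fun w' h => ?_⟩
  -- Relabelling by `τ` gives `w'` the labels of `w`. The two objects may still be parenthesized
  -- differently, but the trivial braid is now a morphism between them.
  let τ := w.label * w'.label⁻¹
  have hl : (w'.relabel τ).label = w.label := inv_mul_cancel_right _ _
  have e1 : (w'.relabel τ).label * braids.perm k 1 = w.label := by rw [map_one, mul_one, hl]
  have e2 : w.label * braids.perm k 1 = (w'.relabel τ).label := by rw [map_one, mul_one, hl]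
  have e := app_conj F hk (⟨1, e1⟩ : braids.Hom w (w'.relabel τ)) g ⟨1, e2⟩ (mul_one 1) hg
  have e3 : Hom.comp (⟨1, e1⟩ : braids.Hom w (w'.relabel τ))
      (g.comp (⟨1, e2⟩ : braids.Hom (w'.relabel τ) w)) =
      Hom.relabel τ (⟨g.1, h⟩ : braids.Hom w' w') :=
    Hom.ext ((one_mul _).trans (mul_one _))
  rw [e3] at e
  exact (congrArg Subtype.val (TruncMor.app_relabel F k hk τ
    (⟨g.1, h⟩ : braids.Hom w' w'))).symm.trans e

/-- The quotient of `f'` by `f` is an automorphism of `w`, so `f'` is `f` precomposed with it, and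
its image is trivial exactly when the two images agree. -/
theorem app_eq_iff {w w' : PaObj k} (f f' : braids.Hom w w') :
    TruncMor.app F k hk f = TruncMor.app F k hk f' ↔ f.1⁻¹ * f'.1 ∈ pureKer F k hk := by
  have hp : w.label * braids.perm k (f.1⁻¹ * f'.1) = w.label := by
    rw [map_mul, map_inv, ← mul_assoc, mul_inv_eq_iff_eq_mul.mpr f.2.symm, f'.2]
  have e : f' = f.comp (⟨f.1⁻¹ * f'.1, hp⟩ : braids.Hom w w) :=
    Hom.ext (mul_inv_cancel_left f.1 f'.1).symm
  have e' := congrArg Subtype.val (TruncMor.app_comp F k hk f (⟨f.1⁻¹ * f'.1, hp⟩ : braids.Hom w w))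
  rw [← e] at e'
  change _ = _ * _ at e'
  constructor
  · intro h
    rw [h] at e'
    exact mem_pureKer_of_app_eq_one F hk ⟨_, hp⟩ (left_eq_mul.mp e')
  · intro h
    refine Hom.ext ?_
    rw [e', h.2 w hp, mul_one]

theorem IsOnto.exists_iso_of_pureKer {U : StrandGroups} {P : braids ⟶ T} {F : braids ⟶ U}
    (hP : IsOnto P) (hF : IsOnto F)
    (h : ∀ (k : ℕ) (hk : k ≤ 3), pureKer P k hk = pureKer F k hk) :
    ∃ e : T ≅ U, P ≫ e.hom = F :=
  hP.exists_iso hF fun k hk w w' f f' => by rw [app_eq_iff, app_eq_iff, h]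

end StrandGroups

/-! ### The kernel in arity 4 determines the kernels in lower arities -/

instance (k : ℕ) : Nonempty (PaObj k) := by
  suffices ∃ t : BinaryTree Unit, t.numNodes = k by
    obtain ⟨t, ht⟩ := this
    exact ⟨⟨t, ht, 1⟩⟩
  induction k with
  | zero => exact ⟨.nil, rfl⟩
  | succ k ih =>
    obtain ⟨t, ht⟩ := ih
    exact ⟨.node () t .nil, by simp [ht]⟩

theorem Br.cab_one {k : ℕ} (m : ℕ) (p : Fin (k + 1)) : Br.cab m p (1 : Br k) = 1 := by
  have := Br.cab_mul m p (1 : Br k) 1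
  rw [mul_one, map_one, Equiv.Perm.one_apply] at this
  exact left_eq_mul.mp this

section Levels

variable {N : NFI} (F : braids ⟶ braidsMod N)

/-- Cabling is insertion of an identity morphism, so `F` carries the cabling of `f` to the class of
the cabling of `h`, where `h` represents the image of `f`. -/
theorem cab_mem_pureKer_iff {k m : ℕ} (hkm : k + m ≤ 3) {w : PaObj k} (f : braids.Hom w w)
    {h : Br k} (hh : (TruncMor.app F k (by omega) f).1 = (h : Br k ⧸ (N.level k).toSubgroup))
    (p : Fin (k + 1)) :
    Br.cab m p f.1 ∈ pureKer F (k + m) hkm ↔ Br.cab m p h ∈ N.level (k + m) := by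
  obtain ⟨v⟩ : Nonempty (PaObj m) := inferInstance
  have e := congrArg Subtype.val
    -- Operadic insertion is indexed by labels and cabling by positions: the label `w.label p` sits
    -- in position `p`.
    (TruncMor.app_ins F k m hkm f (w.label p) (Hom.id (S := braids) v))
  rw [TruncMor.app_id] at e
  have e1 : (f.ins (w.label p) (Hom.id (S := braids) v)).1 = Br.cab m p f.1 := by
    change Br.cab m (w.label.symm (w.label p)) f.1 * Br.place (k + m) _ _ (1 : Br m) = _
    rw [Equiv.symm_apply_apply, map_one, mul_one]
  have e2 : ((TruncMor.app F k (by omega) f).ins (w.label p)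
      (Hom.id (S := braidsMod N) v)).1 = (Br.cab m p h : Br (k + m) ⧸ (N.level (k + m)).toSubgroup)
      := by
    change Br.insQuot _ _ _ (N.level_le_cabPull k m) (N.level_le_placePull k m) (w.label.symm (w.label p))
      (TruncMor.app F k (by omega) f).1 ((1 : Br m) : Br m ⧸ (N.level m).toSubgroup) = _
    rw [hh, Equiv.symm_apply_apply, Br.insQuot_mk, Br.ins, map_one, mul_one]
  rw [e2] at e
  have e3 : (Br.cab m p h : Br (k + m) ⧸ (N.level (k + m)).toSubgroup) = 1 ↔
      Br.cab m p h ∈ N.level (k + m) := QuotientGroup.eq_one_iff _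
  rw [← e3, ← e, ← e1]
  exact ⟨fun h => h.2 _ _, fun h => mem_pureKer_of_app_eq_one F hkm _ h⟩

/-- The counterpart of `cab_mem_pureKer_iff` with the roles exchanged: adding trivial strands is
insertion into an identity morphism. -/
theorem place_mem_pureKer_iff {m n q : ℕ} (hq : q + m ≤ n) (hn : n ≤ 3) {w : PaObj m}
    (f : braids.Hom w w) {h : Br m}
    (hh : (TruncMor.app F m (by omega) f).1 = (h : Br m ⧸ (N.level m).toSubgroup)) :
    Br.place n q hq f.1 ∈ pureKer F n hn ↔ Br.place n q hq h ∈ N.level n := by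
  obtain ⟨k, rfl⟩ : ∃ k, n = k + m := ⟨n - m, by omega⟩
  obtain ⟨v⟩ : Nonempty (PaObj k) := inferInstance
  let p : Fin (k + 1) := ⟨q, by omega⟩
  have e := congrArg Subtype.val
    (TruncMor.app_ins F k m hn (Hom.id (S := braids) v) (v.label p) f)
  rw [TruncMor.app_id] at e
  have e1 : ((Hom.id (S := braids) v).ins (v.label p) f).1 = Br.place (k + m) q hq f.1 := by
    change Br.cab m (v.label.symm (v.label p)) (1 : Br k) *
      Br.place (k + m) (v.label.symm (v.label p)).val (by omega) f.1 = _
    rw [Br.cab_one, one_mul]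
    congr 2
    rw [Equiv.symm_apply_apply]
  have e2 : ((Hom.id (S := braidsMod N) v).ins (v.label p) (TruncMor.app F m (by omega) f)).1 =
      (Br.place (k + m) q hq h : Br (k + m) ⧸ (N.level (k + m)).toSubgroup) := by
    change Br.insQuot _ _ _ (N.level_le_cabPull k m) (N.level_le_placePull k m) (v.label.symm (v.label p))
      ((1 : Br k) : Br k ⧸ (N.level k).toSubgroup) (TruncMor.app F m (by omega) f).1 = _
    rw [hh, Equiv.symm_apply_apply, Br.insQuot_mk, Br.ins, Br.cab_one, one_mul]
  rw [e2] at e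
  have e3 : (Br.place (k + m) q hq h : Br (k + m) ⧸ (N.level (k + m)).toSubgroup) = 1 ↔
      Br.place (k + m) q hq h ∈ N.level (k + m) := QuotientGroup.eq_one_iff _
  rw [← e3, ← e, ← e1]
  exact ⟨fun h => h.2 _ _, fun h => mem_pureKer_of_app_eq_one F hn _ h⟩

/-- If `h` represents the image of `g`, then `g` is killed exactly when `h` lies in `N.level k`. By
`hN` this is tested on the doublings and one-strand extensions of `h`. These represent the images of
the same constructions on `g`, so the test becomes membership of the latter in the kernel one arity
higher. -/
theorem pureKer_eq_pull {k : ℕ} (hk : k + 1 ≤ 3) (hN : N.level k = Br.pull k (N.level (k + 1)))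
    (L : FiniteIndexNormalSubgroup (Br (k + 1))) (hL : pureKer F (k + 1) hk = L.toSubgroup) :
    pureKer F k (by omega) = (Br.pull k L).toSubgroup := by
  ext g
  by_cases hg : Br.perm k g = 1
  swap
  -- Both subgroups consist of pure braids.
  · exact ⟨fun h => absurd h.1 hg, fun h => absurd h.1.1 hg⟩
  obtain ⟨w⟩ : Nonempty (PaObj k) := inferInstance
  have hw : w.label * braids.perm k g = w.label := mul_eq_left.mpr hg
  let f : braids.Hom w w := ⟨g, hw⟩
  obtain ⟨h, hh⟩ := QuotientGroup.mk_surjective (TruncMor.app F k (by omega) f).1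
  have hp : Br.perm k h = 1 := by
    have := (TruncMor.app F k (by omega) f).2
    rw [← hh] at this
    exact mul_eq_left.mp this
  have h1 : g ∈ pureKer F k (by omega) ↔ h ∈ N.level k := by
    have e3 : (h : Br k ⧸ (N.level k).toSubgroup) = 1 ↔ h ∈ N.level k := QuotientGroup.eq_one_iff _
    rw [← e3, hh]
    exact ⟨fun h => h.2 w hw, fun h => mem_pureKer_of_app_eq_one F _ f h⟩
  have mem : ∀ (L : FiniteIndexNormalSubgroup (Br (k + 1))) (x : Br k), Br.perm k x = 1 →
      (x ∈ Br.pull k L ↔ (∀ p, Br.cab 1 p x ∈ L.toSubgroup) ∧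
        Br.place (k + 1) 0 (by omega) x ∈ L.toSubgroup ∧
        Br.place (k + 1) 1 (by omega) x ∈ L.toSubgroup) :=
    fun L x hx => ⟨fun h => ⟨fun p => h.1.2 p, h.2⟩, fun h => ⟨⟨hx, fun p => h.1 p⟩, h.2⟩⟩
  rw [h1, hN]
  refine (mem _ h hp).trans (Iff.trans ?_ (mem L g hg).symm)
  rw [← hL]
  exact and_congr (forall_congr' fun p => (cab_mem_pureKer_iff F hk f hh.symm p).symm)
    (and_congr (place_mem_pureKer_iff F _ hk f hh.symm).symm
      (place_mem_pureKer_iff F _ hk f hh.symm).symm)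

/-- The kernels of a morphism in the arities at most 4 are induced by its kernel in arity 4. -/
theorem pureKer_eq_level (K : NFI) (hK : pureKer F 3 le_rfl = K.1.toSubgroup) (k : ℕ)
    (hk : k ≤ 3) : pureKer F k hk = (K.level k).toSubgroup := by
  have h2 := pureKer_eq_pull F (k := 2) (by omega) rfl _ hK
  have h1 := pureKer_eq_pull F (k := 1) (by omega) rfl _ h2
  have h0 := pureKer_eq_pull F (k := 0) (by omega) rfl _ h1
  obtain rfl | rfl | rfl | rfl : k = 0 ∨ k = 1 ∨ k = 2 ∨ k = 3 := by omega
  · exact h0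
  · exact h1
  · exact h2
  · exact hK

/-- The distinguished object `PaObj.std4` detects the whole kernel. Normality in the full braid
group, and not merely in the pure one, follows from this. -/
theorem kerPB4_eq_pureKer : kerPB4 F = pureKer F 3 le_rfl := by
  ext g
  constructor
  · rintro ⟨x, hx, rfl⟩
    exact mem_pureKer_of_app_eq_one F le_rfl (w := PaObj.std4) _ hx
  · intro hg
    exact ⟨⟨g, hg.1⟩, hg.2 PaObj.std4 _, rfl⟩

instance kerPB4_normal : (kerPB4 F).Normal := by
  rw [kerPB4_eq_pureKer]
  infer_instance

/-- The kernel has finite index in the pure braid group because `onPB4` has a finite target, and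
indices multiply along the inclusion of the pure braid group. -/
instance kerPB4_finiteIndex : (kerPB4 F).FiniteIndex := by
  have : (onPB4 F).ker.FiniteIndex := inferInstance
  refine ⟨?_⟩
  rw [kerPB4, Subgroup.index_map_subtype]
  exact mul_ne_zero this.index_ne_zero (Br.PB_finiteIndex 3).index_ne_zero

end Levels

/-! ### The projection modulo `N` and the first isomorphism theorem -/

theorem projMod_isOnto (N : NFI) : IsOnto (projMod N) := by
  rintro k hk w w' ⟨y, hy⟩
  obtain ⟨g, rfl⟩ := QuotientGroup.mk_surjective y
  exact ⟨⟨g, hy⟩, rfl⟩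

theorem pureKer_projMod (N : NFI) (k : ℕ) (hk : k ≤ 3) :
    pureKer (projMod N) k hk = (N.level k).toSubgroup := by
  refine pureKer_eq_level (projMod N) N ?_ k hk
  ext g
  have e : (g : Br 3 ⧸ N.1.toSubgroup) = 1 ↔ g ∈ N.1.toSubgroup := QuotientGroup.eq_one_iff _
  rw [← e]
  refine ⟨fun h => h.2 PaObj.std4 (mul_eq_left.mpr h.1), fun h => ⟨N.2 (e.mp h), fun _ _ => h⟩⟩

/-- A morphism onto the quotient by `N` induces an isomorphism from the quotient by its kernel. -/
theorem exists_iso_of_kerPB4_eq {N : NFI} (F : braids ⟶ braidsMod N) (hF : IsOnto F) (K : NFI)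
    (hK : K.1.toSubgroup = kerPB4 F) :
    ∃ e : braidsMod K ≅ braidsMod N, projMod K ≫ e.hom = F := by
  refine (projMod_isOnto K).exists_iso_of_pureKer hF fun k hk => ?_
  rw [pureKer_projMod, pureKer_eq_level F K (by rw [hK, kerPB4_eq_pureKer])]

theorem kerPB4_projMod (N : NFI) : kerPB4 (projMod N) = N.1.toSubgroup := by
  rw [kerPB4_eq_pureKer, pureKer_projMod]
  rfl

theorem kerPB4_comp_iso {K N : NFI} (F : braids ⟶ braidsMod K) (e : braidsMod K ≅ braidsMod N) :
    kerPB4 (F ≫ e.hom) = kerPB4 F := by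
  rw [kerPB4_eq_pureKer, kerPB4_eq_pureKer]
  have le : ∀ {K N : NFI} (F : braids ⟶ braidsMod K) (G : braidsMod K ⟶ braidsMod N),
      pureKer F 3 le_rfl ≤ pureKer (F ≫ G) 3 le_rfl := by
    rintro K N F G g ⟨hg, hg'⟩
    refine ⟨hg, fun w h => ?_⟩
    have e : TruncMor.app F 3 le_rfl (⟨g, h⟩ : braids.Hom w w) = Hom.id w := Hom.ext (hg' w h)
    exact congrArg Subtype.val
      ((congrArg (TruncMor.app G 3 le_rfl) e).trans (TruncMor.app_id G 3 le_rfl w))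
  refine le_antisymm ?_ (le F e.hom)
  -- Composition can only enlarge a kernel; composing back with `e.inv` gives the reverse inclusion.
  have := le (F ≫ e.hom) e.inv
  rwa [Category.assoc, e.hom_inv_id, Category.comp_id] at this

/-! ### Density of braids in the completion and morphisms with open fibres -/

section Completion

/-- The fibres of a morphism from the completion are open. -/
def HasOpenFibers {T : StrandGroups} (F : braidsHat ⟶ T) : Prop :=
  ∀ (k : ℕ) (hk : k ≤ 3) (w w' : PaObj k) (y : T.Hom w w'),
    IsOpen {x : braidsHat.Hom w w' | TruncMor.app F k hk x = y}

theorem BrHat.isOpen_proj_eq {k : ℕ} (N : FiniteIndexNormalSubgroup (Br k))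
    (q : Br k ⧸ N.toSubgroup) : IsOpen {x : BrHat k | BrHat.proj N x = q} := by
  -- The completion sits inside the product of the finite quotients, each with the discrete
  -- topology.
  let _ : TopologicalSpace (Br k ⧸ N.toSubgroup) := ⊥
  have : DiscreteTopology (Br k ⧸ N.toSubgroup) := ⟨rfl⟩
  have hc : Continuous fun x : BrHat k => BrHat.proj N x :=
    (continuous_apply N).comp continuous_subtype_val
  exact (isOpen_discrete {q}).preimage hc

theorem BrHat.isOpen_perm_eq {k : ℕ} (π : Equiv.Perm (Fin (k + 1))) :
    IsOpen {x : BrHat k | BrHat.perm k x = π} := by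
  have : {x : BrHat k | BrHat.perm k x = π} =
      ⋃ q ∈ {q | Br.permQuot (FiniteIndexNormalSubgroup.ofSubgroup (Br.PB k)) le_rfl q = π},
        {x : BrHat k | BrHat.proj _ x = q} := by
    ext x
    simp [BrHat.perm]
    rfl
  rw [this]
  exact isOpen_biUnion fun q _ => BrHat.isOpen_proj_eq _ q

/-- Prescribing the permutation is an open condition, so an open set of morphisms is already open in
the completed braid group and meets the dense image of the braid group. The braid found there has
the permutation required of a morphism from `w` to `w'`. -/
theorem exists_canI_mem {k : ℕ} (hk : k ≤ 3) {w w' : PaObj k} (U : Set (braidsHat.Hom w w'))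
    (hU : IsOpen U) (hne : U.Nonempty) : ∃ f : braids.Hom w w', TruncMor.app canI k hk f ∈ U := by
  have ho : IsOpen {x : BrHat k | w'.label * BrHat.perm k x = w.label} := by
    simpa only [← eq_inv_mul_iff_mul_eq] using BrHat.isOpen_perm_eq (w'.label⁻¹ * w.label)
  have hV : IsOpen (Subtype.val '' U : Set (BrHat k)) := ho.isOpenMap_subtype_val U hU
  obtain ⟨_, ⟨⟨x, hx⟩, hxU, rfl⟩, g, hg⟩ :=
    (ProfiniteGrp.ProfiniteCompletion.denseRange (GrpCat.of (Br k))).inter_open_nonempty _ hV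
      (hne.image _)
  obtain rfl : BrHat.eta k g = x := hg
  exact ⟨⟨g, hx⟩, hxU⟩

/-- The fibres of `F` and `G` through a point `x` meet in a nonempty open set. A braid in it
transfers the agreement of `F` and `G` to `x`. Open fibres stand in for continuity, so the target
needs no topology. -/
theorem HasOpenFibers.ext {T : StrandGroups} {F G : braidsHat ⟶ T} (hF : HasOpenFibers F)
    (hG : HasOpenFibers G) (h : canI ≫ F = canI ≫ G) : F = G := by
  refine truncMor_ext fun k hk w w' x => ?_
  obtain ⟨f, h1, h2⟩ := exists_canI_mem hk _ ((hF k hk w w' _).inter (hG k hk w w' _))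
    ⟨x, rfl, rfl⟩
  have h3 : TruncMor.app F k hk (TruncMor.app canI k hk f) =
      TruncMor.app G k hk (TruncMor.app canI k hk f) := by
    rw [← comp_app, h, comp_app]
  exact (Eq.symm h1).trans (h3.trans h2)

theorem HasOpenFibers.isOnto_canI_comp {T : StrandGroups} {F : braidsHat ⟶ T}
    (hF : HasOpenFibers F) (hF' : IsOnto F) : IsOnto (canI ≫ F) := by
  intro k hk w w' y
  obtain ⟨f, hf⟩ := exists_canI_mem hk _ (hF k hk w w' y) (hF' k hk w w' y)
  exact ⟨f, hf⟩

theorem projHat_hasOpenFibers (N : NFI) : HasOpenFibers (projHat N) := by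
  intro k hk w w' y
  have := (BrHat.isOpen_proj_eq (N.level k) y.1).preimage
    (continuous_subtype_val (p := fun x : BrHat k => w'.label * BrHat.perm k x = w.label))
  exact (congrArg IsOpen (Set.ext fun x => Subtype.ext_iff)).mpr this

theorem HasOpenFibers.comp {T U : StrandGroups} {F : braidsHat ⟶ T} (hF : HasOpenFibers F)
    (G : T ⟶ U) : HasOpenFibers (F ≫ G) := by
  intro k hk w w' y
  have : {x : braidsHat.Hom w w' | TruncMor.app (F ≫ G) k hk x = y} =
      ⋃ z ∈ {z | TruncMor.app G k hk z = y}, {x | TruncMor.app F k hk x = z} := by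
    ext x
    simp [comp_app]
  rw [this]
  exact isOpen_biUnion fun z _ => hF k hk w w' z

/-- This is where the continuity of the automorphism enters. -/
theorem HasOpenFibers.trunc_comp {U : StrandGroups} {F : braidsHat ⟶ U} (hF : HasOpenFibers F)
    (T : GTHat) : HasOpenFibers (GTHat.trunc T ≫ F) :=
  fun k hk w w' y => (hF k hk w w' y).preimage (T.2.2.2.2 k w w').1

theorem canI_projHat (N : NFI) : canI ≫ projHat N = projMod N := rfl

theorem projHat_isOnto (N : NFI) : IsOnto (projHat N) := by
  intro k hk w w' y
  obtain ⟨f, rfl⟩ := projMod_isOnto N k hk w w' y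
  exact ⟨TruncMor.app canI k hk f, rfl⟩

end Completion

/-! ### The action on `NFI` and the functor to GT-shadows -/

namespace GTHat

theorem trunc_mul (T U : GTHat) : trunc (T * U) = trunc U ≫ trunc T := rfl

/-- On the completion, the automorphism followed by the projection is onto; each of its fibres is
open and nonempty, hence contains a braid. -/
theorem shadow_isOnto (T : GTHat) (N : NFI) : IsOnto (shadow T N) := by
  refine ((projHat_hasOpenFibers N).trunc_comp T).isOnto_canI_comp fun k hk w w' y => ?_
  obtain ⟨x, rfl⟩ := projHat_isOnto N k hk w w' y
  exact ⟨(T.1 k w w').symm x,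
    congrArg (TruncMor.app (projHat N) k hk) ((T.1 k w w').apply_symm_apply x)⟩

theorem shadow_one (N : NFI) : shadow 1 N = projMod N := rfl

/-- The kernel of the GT-shadow `T_N`, as an element of `NFI`. -/
def act (T : GTHat) (N : NFI) : NFI :=
  ⟨FiniteIndexNormalSubgroup.ofSubgroup (kerPB4 (shadow T N)), by
    rintro _ ⟨x, _, rfl⟩
    exact x.2⟩

theorem exists_iso (T : GTHat) {K N : NFI} (hK : act T N = K) :
    ∃ e : braidsMod K ≅ braidsMod N, projMod K ≫ e.hom = shadow T N :=
  exists_iso_of_kerPB4_eq _ (shadow_isOnto T N) K (by rw [← hK]; rfl)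

/-- The isomorphism of quotients which corresponds to the GT-shadow `T_N`. -/
noncomputable def shadowIso (T : GTHat) {K N : NFI} (hK : act T N = K) :
    braidsMod K ≅ braidsMod N := (exists_iso T hK).choose

theorem projMod_shadowIso (T : GTHat) {K N : NFI} (hK : act T N = K) :
    projMod K ≫ (shadowIso T hK).hom = shadow T N := (exists_iso T hK).choose_spec

/-- The automorphism descends to the finite quotients: both sides have open fibres and restrict to
the shadow of `T` on braids. The shadow sees only uncompleted braids, whereas composing it with
another automorphism requires the square on the whole completion. -/
theorem trunc_projHat (T : GTHat) {K N : NFI} (hK : act T N = K) :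
    trunc T ≫ projHat N = projHat K ≫ (shadowIso T hK).hom := by
  refine ((projHat_hasOpenFibers N).trunc_comp T).ext ((projHat_hasOpenFibers K).comp _) ?_
  rw [← Category.assoc canI (projHat K), canI_projHat, projMod_shadowIso]
  rfl

/-- In the product `U` is applied first, so the square of `T` moves the projection modulo `N` past
`T`, and the shadow of `U` with target `K` appears. -/
theorem shadow_mul (T U : GTHat) {K N : NFI} (hK : act T N = K) :
    shadow (T * U) N = shadow U K ≫ (shadowIso T hK).hom := by
  rw [shadow, trunc_mul, Category.assoc, trunc_projHat T hK]
  rfl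

theorem act_one (N : NFI) : act 1 N = N := by
  refine Subtype.ext (FiniteIndexNormalSubgroup.toSubgroup_injective ?_)
  exact kerPB4_projMod N

theorem act_mul (T U : GTHat) (N : NFI) : act (T * U) N = act U (act T N) := by
  refine Subtype.ext (FiniteIndexNormalSubgroup.toSubgroup_injective ?_)
  change kerPB4 (shadow (T * U) N) = kerPB4 (shadow U (act T N))
  -- The shadow of the product and the shadow of `U` with target `act T N` differ by an isomorphism
  -- of their targets, which leaves the kernel unchanged.
  rw [shadow_mul T U rfl, kerPB4_comp_iso]

theorem shadowIso_one {N : NFI} (h : act 1 N = N) : shadowIso 1 h = Iso.refl _ := by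
  refine Iso.ext ((projMod_isOnto N).cancel ?_)
  rw [projMod_shadowIso, shadow_one]
  rfl

theorem shadowIso_mul (T U : GTHat) {K L N : NFI} (hT : act T N = K) (hU : act U K = L)
    (h : act (T * U) N = L) : shadowIso (T * U) h = shadowIso U hU ≪≫ shadowIso T hT := by
  refine Iso.ext ((projMod_isOnto L).cancel ?_)
  rw [projMod_shadowIso, shadow_mul T U hT, Iso.trans_hom, ← Category.assoc, projMod_shadowIso]

/-- The right action of `GTHat` on `NFI`. -/
@[reducible] def mulAction : MulAction GTHatᵐᵒᵖ NFI where
  smul T N := act T.unop N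
  one_smul := act_one
  -- Passing to the opposite group reverses the product, which turns the right action law `act_mul`
  -- into a left one.
  mul_smul T U N := act_mul U.unop T.unop N

end GTHat

theorem proposition2p2 :
    (∀ (T : GTHat) (N : NFI), IsGTShadow (GTHat.shadow T N)) ∧
    ∃ A : MulAction GTHatᵐᵒᵖ NFI,
      (∀ (T : GTHat) (N : NFI),
        (MulOpposite.op T • N).1.toSubgroup = kerPB4 (GTHat.shadow T N)) ∧
      ∃ (PR : TransformationGroupoid GTHat NFI ⥤ GTSh)
        (hobj : ∀ x : TransformationGroupoid GTHat NFI, PR.obj x = GTSh.mk x.pt),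
        ∀ (x y : TransformationGroupoid GTHat NFI) (f : x ⟶ y),
          GTSh.toShadow (eqToHom (hobj x).symm ≫ PR.map f ≫ eqToHom (hobj y)) =
            GTHat.shadow (TransformationGroupoid.elt f) y.pt := by
  refine ⟨GTHat.shadow_isOnto, GTHat.mulAction, fun _ _ => rfl, ?_⟩
  let _ := GTHat.mulAction
  let PR : TransformationGroupoid GTHat NFI ⥤ GTSh :=
    { obj := fun x => GTSh.mk x.pt
      map := fun f => GTHat.shadowIso f.1 f.2
      map_id := fun x => GTHat.shadowIso_one _
      -- The composite of `f` and then `g` has underlying element `g.1 * f.1`, hence the exchanged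
      -- arguments.
      map_comp := fun f g => GTHat.shadowIso_mul g.1 f.1 g.2 f.2 _ }
  refine ⟨PR, fun _ => rfl, fun x y f => ?_⟩
  rw [eqToHom_refl, eqToHom_refl, Category.id_comp, Category.comp_id]
  exact GTHat.projMod_shadowIso f.1 f.2
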